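/- Let $G$ be a Hausdorff topological group with identity $e$, and let $\mathscr U_e(G)$ be the filter of neighbourhoods of $e$. *Amenability.* Let $\mathrm{RUC}_b(G)$ be the real vector space of all bounded functions $f\colon G\to\mathbb R$ that are uniformly continuous for the right uniformity of $G$, i.e. for every $\varepsilon>0$ there is $U\in\mathscr U_e(G)$ such that $|f(x)-f(y)|<\varepsilon$ whenever $xy^{-1}\in U$. For $g\in G$ let $\lambda_g\colon G\to G$, $x\mapsto gx$. The group $G$ is amenable if there is a positive linear map $\mu\colon\mathrm{RUC}_b(G)\to\mathbb R$ with $\mu(\mathbf 1)=1$ and $\mu(f\circ\lambda_g)=\mu(f)$ for all $f\in\mathrm{RUC}_b(G)$ and $g\in G$. *Wobbling groups.* The wobbling group $W(\Gamma,X)$ of an action of a group $\Gamma$ on a set $X$ is the group of all $\gamma\in\mathrm{Sym}(X)$ for which there is a finite set $E\subseteq\Gamma$ such that for every $x\in X$ there is $g\in E$ with $\gamma(x)=gx$. For a map $\alpha\colon I\to\mathrm{Sym}(X)$, where $I$ is a set, let $\Gamma(\alpha)$ be the subgroup of $\mathrm{Sym}(X)$ generated by $\{\alpha(i)\mid i\in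 I\}$, and let $W(\alpha)=W(\Gamma(\alpha),X)$. A subgroup of $\mathrm{Sym}(X)$ is semi-regular if none of its non-identity elements has a fixed point in $X$. *Perturbations.* For $U\in\mathscr U_e(G)$ let $$\mathscr N_G(U)=\{\alpha\colon G\to\mathrm{Sym}(G)\mid \alpha(g)(h)\in Ugh\ \text{ for all } g,h\in G\}$$ be the set of $U$-perturbations of the left translation action of $G$ on itself. The $U$-wobbling group of $G$ is $W_U(G)=W(\alpha_U)$, where $\alpha_U\colon G\to\mathrm{Sym}(G\times\mathscr N_G(U))$ is given by $\alpha_U(g)(x,\alpha)=(\alpha(g)(x),\alpha)$. Let $F_2$ be the free group on two generators. Then the following are equivalent. 1. $G$ is not amenable. 2. There exists $U\in\mathscr U_e(G)$ such that, for every $\alpha\in\mathscr N_G(U)$, the group $F_2$ is isomorphic to a semi-regular subgroup of $W(\alpha)$. 3. There exists $U\in\mathscr U_e(G)$ such that $F_2$ is isomorphic to a semi-regular subgroup of $W_U(G)$. -/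

import Mathlib

open scoped Topology

namespace Wobbling

section Amenability

variable (G : Type*) [Group G] [TopologicalSpace G] [IsTopologicalGroup G]

/-- A real-valued function on a topological group `G` is right-uniformly continuous if it is
uniformly continuous with respect to the right uniformity of `G`, whose entourages are the sets
containing `{(x, y) | y * x⁻¹ ∈ U}` for some identity neighbourhood `U`. -/
def RightUniformContinuous (f : G → ℝ) : Prop :=
  @UniformContinuous G ℝ (IsTopologicalGroup.rightUniformSpace G) inferInstance f

/-- `RUC_b(G)`: the real vector space of all bounded right-uniformly continuous functions
`G → ℝ`. -/
def RUCb : Submodule ℝ (G → ℝ) where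
  carrier := {f | RightUniformContinuous G f ∧ ∃ C : ℝ, ∀ x, |f x| ≤ C}
  zero_mem' := by
    let _ : UniformSpace G := IsTopologicalGroup.rightUniformSpace G
    exact ⟨uniformContinuous_const, 0, fun x => by simp⟩
  add_mem' := by
    let _ : UniformSpace G := IsTopologicalGroup.rightUniformSpace G
    rintro f g ⟨hf, C, hC⟩ ⟨hg, D, hD⟩
    exact ⟨UniformContinuous.add hf hg, C + D,
      fun x => (abs_add_le _ _).trans (add_le_add (hC x) (hD x))⟩
  smul_mem' := by
    let _ : UniformSpace G := IsTopologicalGroup.rightUniformSpace G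
    rintro c f ⟨hf, C, hC⟩
    refine ⟨UniformContinuous.const_smul hf c, |c| * C, fun x => ?_⟩
    rw [Pi.smul_apply, smul_eq_mul, abs_mul]
    exact mul_le_mul_of_nonneg_left (hC x) (abs_nonneg c)

/-- The constant function `1`, as an element of `RUC_b(G)`. -/
def RUCb.one : RUCb G :=
  ⟨fun _ => 1, by
    let _ : UniformSpace G := IsTopologicalGroup.rightUniformSpace G
    exact ⟨uniformContinuous_const, 1, fun x => by simp⟩⟩

variable {G}

/-- The left translate `f ∘ λ_g`, that is `x ↦ f (g * x)`, of an element `f` of `RUC_b(G)`. -/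
def RUCb.translate (g : G) (f : RUCb G) : RUCb G :=
  ⟨fun x => (f : G → ℝ) (g * x), by
    let _ : UniformSpace G := IsTopologicalGroup.rightUniformSpace G
    obtain ⟨hf, C, hC⟩ := f.2
    refine ⟨?_, C, fun x => hC (g * x)⟩
    have hg : UniformContinuous (fun x : G => g * x) := by
      unfold UniformContinuous
      rw [uniformity_eq_comap_nhds_one' G, Filter.tendsto_comap_iff]
      have h1 : Filter.Tendsto (fun u : G => g * u * g⁻¹) (𝓝 1) (𝓝 1) := by
        have : Continuous (fun u : G => g * u * g⁻¹) := by fun_prop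
        simpa using this.tendsto 1
      refine (h1.comp Filter.tendsto_comap).congr fun p => ?_
      simp [mul_assoc]
    exact UniformContinuous.comp (g := (f : G → ℝ)) hf hg⟩

variable (G)

/-- A topological group `G` is amenable if `RUC_b(G)` admits a left-invariant mean: a linear
functional that is positive, normalized, and invariant under left translations. -/
def IsAmenable : Prop :=
  ∃ μ : RUCb G →ₗ[ℝ] ℝ,
    (∀ f : RUCb G, (∀ x, 0 ≤ (f : G → ℝ) x) → 0 ≤ μ f) ∧
    μ (RUCb.one G) = 1 ∧
    ∀ (g : G) (f : RUCb G), μ (RUCb.translate g f) = μ f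

end Amenability

section WobblingGroups

/-- The wobbling group `W(G, X)` of an action of a group `G` on a set `X`: all permutations `γ`
of `X` for which there is a finite set `E ⊆ G` with `γ x ∈ E x` for every `x`. -/
def wobblingGroup (G X : Type*) [Group G] [MulAction G X] : Subgroup (Equiv.Perm X) where
  carrier := {γ | ∃ E : Finset G, ∀ x : X, ∃ g ∈ E, γ x = g • x}
  one_mem' := ⟨{1}, fun x => ⟨1, by simp, by simp⟩⟩
  mul_mem' := by
    classical
    rintro γ δ ⟨E, hE⟩ ⟨F, hF⟩
    refine ⟨(E ×ˢ F).image fun p => p.1 * p.2, fun x => ?_⟩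
    obtain ⟨h, hh, hx⟩ := hF x
    obtain ⟨g, hg, hy⟩ := hE (δ x)
    refine ⟨g * h, Finset.mem_image.2 ⟨(g, h), Finset.mem_product.2 ⟨hg, hh⟩, rfl⟩, ?_⟩
    rw [Equiv.Perm.mul_apply, hy, hx, mul_smul]
  inv_mem' := by
    classical
    rintro γ ⟨E, hE⟩
    refine ⟨E.image fun g => g⁻¹, fun x => ?_⟩
    obtain ⟨g, hg, hx⟩ := hE (γ⁻¹ x)
    refine ⟨g⁻¹, Finset.mem_image.2 ⟨g, hg, rfl⟩, ?_⟩
    rw [eq_inv_smul_iff, ← hx]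
    exact γ.apply_symm_apply x

/-- `Γ(α)`: the subgroup of `Sym(X)` generated by the range of a family `α : I → Sym(X)`. -/
def generatedGroup {I X : Type*} (α : I → Equiv.Perm X) : Subgroup (Equiv.Perm X) :=
  Subgroup.closure (Set.range α)

/-- `W(α) = W(Γ(α), X)` for a family `α : I → Sym(X)`. -/
def wobblingGroupOf {I X : Type*} (α : I → Equiv.Perm X) : Subgroup (Equiv.Perm X) :=
  wobblingGroup (generatedGroup α) X

/-- The family `⨁ⱼ αⱼ : I → Sym(X × J)` given by `(⨁ⱼ αⱼ)(i)(x, j) = (αⱼ(i)(x), j)`. -/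
def directSum {I X J : Type*} (α : J → I → Equiv.Perm X) : I → Equiv.Perm (X × J) := fun i =>
  { toFun := fun p => (α p.2 i p.1, p.2)
    invFun := fun p => ((α p.2 i).symm p.1, p.2)
    left_inv := fun p => by simp
    right_inv := fun p => by simp }

/-- A subgroup of `Sym(X)` is semi-regular if no non-identity element of it has a fixed point. -/
def IsSemiregular {X : Type*} (H : Subgroup (Equiv.Perm X)) : Prop :=
  ∀ γ ∈ H, γ ≠ 1 → ∀ x : X, γ x ≠ x

/-- The free group on two generators is isomorphic to a semi-regular subgroup of the permutation
group `W`. -/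
def HasSemiregularFreeSubgroup {X : Type*} (W : Subgroup (Equiv.Perm X)) : Prop :=
  ∃ H : Subgroup (Equiv.Perm X), H ≤ W ∧ IsSemiregular H ∧
    Nonempty (FreeGroup (Fin 2) ≃* H)

end WobblingGroups

section Perturbations

variable (G : Type*) [Group G]

/-- The map `λ : G → Sym(G)`, where `λ_g` is the left translation `x ↦ g * x`. -/
def leftTranslation : G → Equiv.Perm G := fun g => Equiv.mulLeft g

variable {G}

/-- `N_α(U)`: all maps `β : G → Sym(G)` such that `β(g)(h) ∈ U α(g)(h)` for all `g, h`. -/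
def perturbationsOf (α : G → Equiv.Perm G) (U : Set G) : Set (G → Equiv.Perm G) :=
  {β | ∀ g h : G, ∃ u ∈ U, β g h = u * α g h}

/-- `N_G(U) = N_λ(U)`: the `U`-perturbations of the left translation action of `G`. -/
def perturbations (U : Set G) : Set (G → Equiv.Perm G) :=
  perturbationsOf (leftTranslation G) U

/-- The `U`-wobbling group `W_U(G) = W(⨁_{α ∈ N_G(U)} α)`, a group of permutations of the set
`G × N_G(U)`. -/
def uWobblingGroup (U : Set G) : Subgroup (Equiv.Perm (G × perturbations U)) :=
  wobblingGroupOf (directSum fun α : perturbations U => (α : G → Equiv.Perm G))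

end Perturbations

end Wobbling

/-!
# Amenability of topological groups and semi-regular free groups of perturbations

If `G` is not amenable, then there are an identity neighbourhood `U`, a finite `E ⊆ G` and `ε > 0`
such that no `U`-perturbation of the left translation has a finite set that is `ε`-invariant under
`E`; otherwise averages over such sets would converge to an invariant mean on `RUC_b(G)`
(`isAmenable_of_perturbations`). The constants do not depend on the perturbation, so the direct sum
of all `U`-perturbations is an expanding action. By Hall's theorem an expanding action contains a
spanning forest of bounded displacement; cutting edges makes it a disjoint union of Cayley graphs of
the free group, along which the free group acts semi-regularly
(`exists_semiregular_hom_of_expansion`). Restricting such an action to the fibres gives the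
statement for every single perturbation (`HasSemiregularFreeSubgroup.of_directSum`).

Conversely, if `G` is amenable, then for every `U` some `U`-perturbation `α` preserves a finitely
additive probability on all subsets of `G`. For discrete `G` the translation action serves. If `G`
is not discrete, a separation argument gives finite multisets that are almost invariant on an
equicontinuous family of bump functions (`IsAmenable.exists_almost_invariant_average`). After a
small displacement these are finite sets `F` disjoint from `g F` and almost matched with `g F` up
to `U`, and exchanging matched points is an involution. The Følner sets for all finite
`E ⊆ G` and all tolerances `1 / (n + 1)` have pairwise disjoint right translates, which allows one
involution per `g` to serve all of them at once (`exists_perturbation_of_matchings`). The resulting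
probability is preserved by the whole wobbling group of `α`, which is impossible if that group
contains a semi-regular free group (`not_invariant_of_semiregular_freeGroup`).
-/

namespace Wobbling

/-! ### Well-founded forests and the Cayley graph of the free group -/

section Forests

variable {X L α : Type*}

/-- If every point of `X` has three candidate children for each label `l`, and no point is a
candidate child of two points, then one child per label can be selected such that no infinite
chain `x, parent x, parent (parent x), …` remains. The parent map is cut along the forward orbit of
one representative per component; at most two children of a point lie on that orbit, one where the
orbit first enters a cycle and one on the cycle. -/
theorem exists_wellFounded_children (f : X × L × Fin 3 → X) (hf : Function.Injective f) :
    ∃ j : X → L → Fin 3, WellFounded fun z x => ∃ l, f (z, l, j z l) = x := by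
  classical
  let p : X → X := fun x => if h : ∃ q, f q = x then h.choose.1 else x
  have hp : ∀ q, p (f q) = q.1 := by
    intro q
    have h : ∃ q', f q' = f q := ⟨q, rfl⟩
    have : p (f q) = h.choose.1 := dif_pos h
    rw [this, hf h.choose_spec]
  let S : Setoid X :=
    { r := fun x y => ∃ n m, p^[n] x = p^[m] y
      iseqv :=
        { refl := fun x => ⟨0, 0, rfl⟩
          symm := fun ⟨n, m, h⟩ => ⟨m, n, h.symm⟩
          trans := by
            rintro x y z ⟨n, m, h⟩ ⟨n', m', h'⟩
            refine ⟨n' + n, m + m', ?_⟩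
            rw [Function.iterate_add_apply, h, ← Function.iterate_add_apply, add_comm,
              Function.iterate_add_apply, h', ← Function.iterate_add_apply] } }
  let rep : X → X := fun x => (Quotient.mk S x).out
  have hrep : ∀ x, ∃ n m, p^[n] (rep x) = p^[m] x := fun x =>
    Quotient.exact (s := S) (Quotient.out_eq (Quotient.mk S x))
  have hrep_eq : ∀ n x, rep (p^[n] x) = rep x := fun n x =>
    congrArg Quotient.out (Quotient.sound (s := S) ⟨0, n, rfl⟩)
  let C : Set X := {y | ∃ n, p^[n] (rep y) = y}
  -- Removing the edges from points of `C` to their parents leaves every parent chain finite.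
  have hC : ∀ x, ∃ n, p^[n] x ∈ C := by
    intro x
    obtain ⟨n, m, h⟩ := hrep x
    exact ⟨m, n, by rw [hrep_eq, h]⟩
  -- If `n < n' < n''` are first hitting times of three points with the same image, then the
  -- orbit is periodic from time `n + 1` on, so `n''` is not a first hitting time.
  have three : ∀ (r : X) (n n' n'' : ℕ), n < n' → n' < n'' → p^[n + 1] r = p^[n' + 1] r →
      (∀ m < n'', p^[m] r ≠ p^[n''] r) → False := by
    intro r n n' n'' h1 h2 h3 h4
    refine h4 ((n'' - n' - 1) + (n + 1)) (by omega) ?_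
    rw [Function.iterate_add_apply, h3, ← Function.iterate_add_apply]
    congr 1
    omega
  have key : ∀ (x : X) (l : L), ∃ j, f (x, l, j) ∉ C := by
    intro x l
    by_contra! hcon
    have hr : ∀ j, rep (f (x, l, j)) = rep x := fun j => by
      rw [← hrep_eq 1, Function.iterate_one, hp]
    have hN : ∀ j, ∃ n, p^[n] (rep x) = f (x, l, j) ∧
        ∀ m < n, p^[m] (rep x) ≠ p^[n] (rep x) := by
      intro j
      have hj : ∃ n, p^[n] (rep x) = f (x, l, j) := by
        rw [← hr j]
        exact hcon j
      refine ⟨Nat.find hj, Nat.find_spec hj, fun m hm h => ?_⟩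
      exact Nat.find_min hj hm (h.trans (Nat.find_spec hj))
    choose N hN hmin using hN
    have hNinj : ∀ i j, i ≠ j → N i ≠ N j := by
      intro i j hij h
      have := hf ((hN i).symm.trans ((congrArg (fun n => p^[n] (rep x)) h).trans (hN j)))
      exact hij (by simpa using this)
    have hstep : ∀ i, p^[N i + 1] (rep x) = x := fun i => by
      rw [Function.iterate_succ_apply', hN i, hp]
    have h3 : ∀ i j k, N i < N j → N j < N k → False := fun i j k hij hjk =>
      three (rep x) _ _ _ hij hjk ((hstep i).trans (hstep j).symm) (hmin k)
    have h01 := hNinj 0 1 (by decide)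
    have h02 := hNinj 0 2 (by decide)
    have h12 := hNinj 1 2 (by decide)
    rcases lt_or_gt_of_ne h01 with h01 | h01 <;> rcases lt_or_gt_of_ne h02 with h02 | h02 <;>
      rcases lt_or_gt_of_ne h12 with h12 | h12
    · exact h3 0 1 2 h01 h12
    · exact h3 0 2 1 h02 h12
    · omega
    · exact h3 2 0 1 h02 h01
    · exact h3 1 0 2 h01 h02
    · omega
    · exact h3 1 2 0 h12 h02
    · exact h3 2 1 0 h12 h01
  choose j hj using key
  refine ⟨j, ⟨fun x => ?_⟩⟩
  obtain ⟨n, hn⟩ := hC x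
  induction n generalizing x with
  | zero =>
    refine ⟨x, ?_⟩
    rintro z ⟨l, rfl⟩
    exact absurd hn (hj z l)
  | succ n ih =>
    refine ⟨x, ?_⟩
    rintro z ⟨l, rfl⟩
    apply ih
    rw [Function.iterate_succ_apply, hp] at hn
    exact hn

open FreeGroup in
theorem mk_mul_notMem_startsWith [DecidableEq α] {s : α × Bool} {w : FreeGroup α}
    (hw : w ∈ startsWith (s.1, !s.2)) : mk [s] * w ∉ startsWith s := by
  have hred := isReduced_toWord (x := w)
  simp only [startsWith, Set.mem_ofPred_eq] at hw ⊢
  rw [toWord_mul, toWord_mk]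
  cases h : w.toWord with
  | nil => simp [h] at hw
  | cons b t =>
    rw [h] at hw hred
    have hb : b = (s.1, !s.2) := by simpa using hw
    have h1 : reduce (reduce [s] ++ b :: t) = t := by
      have ht : IsReduced t := by
        cases t with
        | nil => simp
        | cons b' t => exact (isReduced_cons_cons.1 hred).2
      rw [← ht.reduce_eq]
      apply reduce.eq_of_red
      rw [ht.reduce_eq, reduce_singleton, hb]
      exact Red.Step.to_red Red.Step.cons_not
    rw [h1]
    cases t with
    | nil => simp
    | cons b' t =>
      have h2 := (isReduced_cons_cons.1 hred).1
      intro h3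
      have hb' : b' = s := by simpa using h3
      subst hb hb'
      simp at h2

open FreeGroup in
/-- A well-founded forest in which every point `z` has one child `g z s` for each letter `s` is a
disjoint union of copies of the Cayley graph of the free group. In the Cayley graph the vertex
`w` starting with `t` has no child in direction `t⁻¹`, so the corresponding edge `z → g z t⁻¹`
is cut and its endpoint becomes the identity of a new copy. Which points are such roots depends on
the parent, hence the recursion along the well-founded parent relation. The set `Y` is the set of
roots. -/
theorem exists_equiv_freeGroup_prod [DecidableEq α] (g : X → α × Bool → X)
    (hg : ∀ z s z' s', g z s = g z' s' → z = z' ∧ s = s')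
    (hwf : WellFounded fun z x => ∃ s, g z s = x) :
    ∃ (Y : Set X) (e : X ≃ FreeGroup α × Y), ∀ z s, (e z).1 ∉ startsWith (s.1, !s.2) →
      e (g z s) = (mk [s] * (e z).1, (e z).2) := by
  classical
  let F : (x : X) → ((z : X) → (∃ s, g z s = x) → FreeGroup α × X) → FreeGroup α × X :=
    fun x rec => if h : ∃ z s, g z s = x then
      (if (rec h.choose h.choose_spec).1 ∈
          startsWith (h.choose_spec.choose.1, !h.choose_spec.choose.2) then (1, x)
        else (mk [h.choose_spec.choose] * (rec h.choose h.choose_spec).1,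
          (rec h.choose h.choose_spec).2)) else (1, x)
  let φ : X → FreeGroup α × X := hwf.fix F
  have hφ0 : ∀ x, (¬ ∃ z s, g z s = x) → φ x = (1, x) := by
    intro x hx
    have : φ x = F x fun z _ => φ z := hwf.fix_eq F x
    rw [this]
    exact dif_neg hx
  have hφ1 : ∀ z s, φ (g z s) = if (φ z).1 ∈ startsWith (s.1, !s.2) then (1, g z s)
      else (mk [s] * (φ z).1, (φ z).2) := by
    intro z s
    have h : ∃ z' s', g z' s' = g z s := ⟨z, s, rfl⟩
    have h1 : φ (g z s) = F (g z s) fun z _ => φ z := hwf.fix_eq F _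
    have h2 := hg _ _ _ _ h.choose_spec.choose_spec
    rw [h1]
    simp only [F, dif_pos h, h2.2]
    rw [h2.1]
  have hcase : ∀ x, φ x = (1, x) ∨ ∃ z s, x = g z s ∧ (φ z).1 ∉ startsWith (s.1, !s.2) ∧
      φ x = (mk [s] * (φ z).1, (φ z).2) := by
    intro x
    by_cases hx : ∃ z s, g z s = x
    · obtain ⟨z, s, rfl⟩ := hx
      by_cases hz : (φ z).1 ∈ startsWith (s.1, !s.2)
      · exact Or.inl (by rw [hφ1, if_pos hz])
      · exact Or.inr ⟨z, s, rfl, hz, by rw [hφ1, if_neg hz]⟩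
    · exact Or.inl (hφ0 x hx)
  -- The recursion records, for each point, its root and the word leading to it from the root.
  let Y : Set X := {y | φ y = (1, y)}
  have hY : ∀ x, (φ x).2 ∈ Y := by
    intro x
    induction x using hwf.induction with
    | _ x ih =>
      rcases hcase x with h | ⟨z, s, rfl, -, h⟩
      · rw [h]; exact h
      · rw [h]; exact ih z ⟨s, rfl⟩
  have hinj : ∀ x x', φ x = φ x' → x = x' := by
    intro x
    induction x using hwf.induction with
    | _ x ih =>
      intro x' hxx'
      rcases hcase x with h | ⟨z, s, rfl, hz, h⟩ <;>
        rcases hcase x' with h' | ⟨z', s', rfl, hz', h'⟩ <;> rw [h, h'] at hxx' <;>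
        obtain ⟨h1, h2⟩ := Prod.ext_iff.1 hxx'
      · exact h2
      · exact absurd h1.symm (startsWith.ne_one _ (startsWith_mk_mul _ hz'))
      · exact absurd h1 (startsWith.ne_one _ (startsWith_mk_mul _ hz))
      · have hs : s = s' := by
          by_contra hne
          refine Set.disjoint_left.1 (startsWith.disjoint_iff_ne.2 hne)
            (startsWith_mk_mul _ hz) ?_
          dsimp only at h1
          rw [h1]
          exact startsWith_mk_mul _ hz'
        subst hs
        rw [ih z ⟨s, rfl⟩ z' (Prod.ext (mul_left_cancel h1) h2)]
  have hsurj : ∀ (l : List (α × Bool)), IsReduced l → ∀ y ∈ Y, ∃ x, φ x = (mk l, y) := by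
    intro l
    induction l with
    | nil => exact fun _ y hy => ⟨y, hy⟩
    | cons s t ih =>
      intro hst y hy
      have ht : IsReduced t := by
        cases t with
        | nil => simp
        | cons b t => exact (isReduced_cons_cons.1 hst).2
      obtain ⟨z, hz⟩ := ih ht y hy
      refine ⟨g z s, ?_⟩
      rw [hφ1, if_neg, hz]
      · rw [mul_mk]; rfl
      · rw [hz]
        simp only [startsWith, Set.mem_ofPred_eq, toWord_mk, ht.reduce_eq]
        cases t with
        | nil => simp
        | cons b t =>
          have := (isReduced_cons_cons.1 hst).1
          rintro h
          have hb : b = (s.1, !s.2) := by simpa using h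
          subst hb
          simp at this
  let e0 : X → FreeGroup α × Y := fun x => ((φ x).1, ⟨(φ x).2, hY x⟩)
  have he0 : Function.Bijective e0 := by
    constructor
    · intro x x' h
      have h1 := congrArg Prod.fst h
      have h2 := congrArg (fun q => (q.2 : X)) h
      exact hinj x x' (Prod.ext h1 h2)
    · rintro ⟨w, y, hy⟩
      obtain ⟨x, hx⟩ := hsurj w.toWord isReduced_toWord y hy
      refine ⟨x, ?_⟩
      simp only [e0, hx, mk_toWord]
  refine ⟨Y, Equiv.ofBijective e0 he0, fun z s hz => ?_⟩
  have hz' : (φ z).1 ∉ startsWith (s.1, !s.2) := hz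
  have h := hφ1 z s
  rw [if_neg hz'] at h
  simp only [Equiv.ofBijective_apply, e0, h]

end Forests

/-! ### Semi-regular free groups from expansion -/

section Whyte

variable {Γ X : Type*} [Group Γ] [MulAction Γ X]

open scoped Pointwise in
/-- An expanding action contains, up to bounded displacement, an injection of `X × J` into `X`: a
power of the expanding set multiplies cardinalities by `|J|`, and Hall's theorem applies. -/
theorem exists_injective_of_expansion [DecidableEq Γ] [DecidableEq X] (E : Finset Γ)
    {c : ℝ} (hc : 1 < c)
    (hE : ∀ F : Finset X, c * F.card ≤ (E • F).card) (J : Type*) [Fintype J] :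
    ∃ (E' : Finset Γ) (f : X × J → X), Function.Injective f ∧ ∀ q, ∃ g ∈ E', f q = g • q.1 := by
  classical
  obtain ⟨n, hn⟩ := pow_unbounded_of_one_lt (Fintype.card J : ℝ) hc
  have hpow : ∀ (m : ℕ) (F : Finset X), c ^ m * F.card ≤ ((E ^ m) • F).card := by
    intro m
    induction m with
    | zero => intro F; simp
    | succ m ih =>
      intro F
      have h1 : (E ^ (m + 1)) • F = E • ((E ^ m) • F) := by
        rw [pow_succ', ← smul_eq_mul, smul_assoc]
      rw [h1]
      calc c ^ (m + 1) * F.card = c * (c ^ m * F.card) := by ring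
        _ ≤ c * ((E ^ m) • F).card := mul_le_mul_of_nonneg_left (ih F) (by linarith)
        _ ≤ _ := hE _
  let t : X × J → Finset X := fun q => (E ^ n) • {q.1}
  have hall : ∀ s : Finset (X × J), s.card ≤ (s.biUnion t).card := by
    intro s
    have h1 : s.biUnion t = (E ^ n) • (s.image Prod.fst) := by
      ext y
      simp only [t, Finset.mem_biUnion, Finset.mem_smul, Finset.mem_singleton, Finset.mem_image]
      constructor
      · rintro ⟨q, hq, a, ha, b, rfl, rfl⟩
        exact ⟨a, ha, q.1, ⟨q, hq, rfl⟩, rfl⟩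
      · rintro ⟨a, ha, b, ⟨q, hq, rfl⟩, rfl⟩
        exact ⟨q, hq, a, ha, q.1, rfl, rfl⟩
    have h2 : s.card ≤ (s.image Prod.fst).card * Fintype.card J := by
      have : s ⊆ (s.image Prod.fst) ×ˢ (Finset.univ : Finset J) := fun q hq =>
        Finset.mem_product.2 ⟨Finset.mem_image_of_mem _ hq, Finset.mem_univ _⟩
      exact (Finset.card_le_card this).trans (by rw [Finset.card_product, Finset.card_univ])
    have h3 : (s.card : ℝ) ≤ (s.biUnion t).card := by
      rw [h1]
      refine le_trans ?_ (hpow n _)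
      calc (s.card : ℝ) ≤ (s.image Prod.fst).card * Fintype.card J := by exact_mod_cast h2
        _ = Fintype.card J * (s.image Prod.fst).card := mul_comm _ _
        _ ≤ _ := mul_le_mul_of_nonneg_right hn.le (Nat.cast_nonneg _)
    exact_mod_cast h3
  obtain ⟨f, hf, hft⟩ := (Finset.all_card_le_biUnion_card_iff_exists_injective t).1 hall
  refine ⟨E ^ n, f, hf, fun q => ?_⟩
  obtain ⟨a, ha, b, hb, h⟩ := Finset.mem_smul.1 (hft q)
  rw [Finset.mem_singleton.1 hb] at h
  exact ⟨a, ha, h.symm⟩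

open scoped Pointwise in
/-- Whyte's theorem for actions: if a finite set `E` expands every finite subset of `X` by a factor
`c > 1`, then the free group acts semi-regularly on `X` by elements of the wobbling group. -/
theorem exists_semiregular_hom_of_expansion [DecidableEq Γ] [DecidableEq X] (E : Finset Γ)
    {c : ℝ} (hc : 1 < c)
    (hE : ∀ F : Finset X, c * F.card ≤ (E • F).card) (α : Type*) [Fintype α] :
    ∃ ρ : FreeGroup α →* Equiv.Perm X, (∀ w, ρ w ∈ wobblingGroup Γ X) ∧
      ∀ w, w ≠ 1 → ∀ x, ρ w x ≠ x := by
  classical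
  obtain ⟨E', f, hf, hfE⟩ := exists_injective_of_expansion E hc hE ((α × Bool) × Fin 3)
  obtain ⟨j, hj⟩ := exists_wellFounded_children f hf
  obtain ⟨Y, e, he⟩ := exists_equiv_freeGroup_prod (fun z s => f (z, s, j z s))
    (fun z s z' s' h => ⟨congrArg Prod.fst (hf h), congrArg (fun q => q.2.1) (hf h)⟩) hj
  let ρ : FreeGroup α →* Equiv.Perm X :=
    { toFun := fun w => (e.trans ((Equiv.mulLeft w).prodCongr (Equiv.refl Y))).trans e.symm
      map_one' := by ext x; simp
      map_mul' := fun v w => by ext x; simp [Prod.map] }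
  have hρ : ∀ w x, e (ρ w x) = (w * (e x).1, (e x).2) := fun w x => by simp [ρ, Prod.map]
  refine ⟨ρ, fun w => ?_, fun w hw x hx => hw ?_⟩
  · induction w using FreeGroup.induction_on with
    | C1 => rw [map_one]; exact one_mem _
    | inv_of a h => rw [map_inv]; exact inv_mem h
    | mul v w hv hw => rw [map_mul]; exact mul_mem hv hw
    | of a =>
      refine ⟨E' ∪ E'.image fun g => g⁻¹, fun x => ?_⟩
      by_cases hx : (e x).1 ∈ FreeGroup.startsWith (a, false)
      · -- The generator cancels the first letter of `x`, so `x` moves to its parent.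
        set z := ρ (FreeGroup.of a) x with hz
        have hz1 : (e z).1 ∉ FreeGroup.startsWith (a, true) := by
          rw [hz, hρ]
          exact mk_mul_notMem_startsWith (s := (a, true)) hx
        have h2 : f (z, (a, false), j z (a, false)) = x := by
          apply e.injective
          rw [he z (a, false) (by simpa using hz1), hz, hρ]
          have : FreeGroup.mk [(a, false)] = (FreeGroup.of a)⁻¹ := rfl
          rw [this]
          simp
        obtain ⟨g, hg, h⟩ := hfE (z, (a, false), j z (a, false))
        refine ⟨g⁻¹, Finset.mem_union_right _ (Finset.mem_image_of_mem _ hg), ?_⟩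
        rw [eq_inv_smul_iff, ← h2, h]
      · -- Otherwise `x` moves to its child with label `a`.
        have h2 : f (x, (a, true), j x (a, true)) = ρ (FreeGroup.of a) x := by
          apply e.injective
          rw [he x (a, true) (by simpa using hx), hρ]
          rfl
        obtain ⟨g, hg, h⟩ := hfE (x, (a, true), j x (a, true))
        exact ⟨g, Finset.mem_union_left _ hg, by rw [← h2, h]⟩
  · have := hρ w x
    rw [hx] at this
    simpa using (congrArg Prod.fst this).symm

end Whyte

/-! ### Invariant finitely additive probabilities exclude free groups -/

section InvariantMeasures

variable {I X : Type*}

/-- A finitely additive probability measure defined on all subsets of `X`. -/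
structure IsFinitelyAdditiveProbability (m : Set X → ℝ) : Prop where
  univ : m Set.univ = 1
  nonneg : ∀ A, 0 ≤ m A
  union : ∀ A B, Disjoint A B → m (A ∪ B) = m A + m B

/-- The family `α` of permutations of `X` leaves invariant some finitely additive probability
measure defined on all subsets of `X`. -/
def HasInvariantProbability (α : I → Equiv.Perm X) : Prop :=
  ∃ m : Set X → ℝ, IsFinitelyAdditiveProbability m ∧ ∀ i A, m (α i '' A) = m A

theorem IsFinitelyAdditiveProbability.mono {m : Set X → ℝ}
    (hm : IsFinitelyAdditiveProbability m) {A B : Set X} (h : A ⊆ B) : m A ≤ m B := by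
  have h1 := hm.union A (B \ A) Set.disjoint_sdiff_right
  rw [Set.union_sdiff_cancel h] at h1
  linarith [hm.nonneg (B \ A)]

theorem IsFinitelyAdditiveProbability.union_le {m : Set X → ℝ}
    (hm : IsFinitelyAdditiveProbability m) (A B : Set X) : m (A ∪ B) ≤ m A + m B := by
  have h1 := hm.union A (B \ A) Set.disjoint_sdiff_right
  rw [Set.union_sdiff_self] at h1
  linarith [hm.mono (Set.sdiff_subset : B \ A ⊆ B)]

theorem image_invariant_of_mem_generatedGroup {m : Set X → ℝ} {α : I → Equiv.Perm X}
    (h : ∀ i A, m (α i '' A) = m A) {γ : Equiv.Perm X} (hγ : γ ∈ generatedGroup α) (A : Set X) :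
    m (γ '' A) = m A := by
  induction hγ using Subgroup.closure_induction generalizing A with
  | mem γ hγ => obtain ⟨i, rfl⟩ := hγ; exact h i A
  | one => simp
  | mul γ δ _ _ h1 h2 => rw [Equiv.Perm.coe_mul, Set.image_comp, h1, h2]
  | inv γ _ h1 =>
    rw [← h1, ← Set.image_comp, ← Equiv.Perm.coe_mul, mul_inv_cancel, Equiv.Perm.coe_one,
      Set.image_id]

/-- A finitely additive measure invariant under an action is invariant under its wobbling group,
whose elements are finite piecewise combinations of group elements. -/
theorem image_invariant_of_mem_wobblingGroup {Γ : Type*} [Group Γ] [MulAction Γ X]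
    {m : Set X → ℝ} (hm : IsFinitelyAdditiveProbability m)
    (h : ∀ (g : Γ) A, m ((fun x => g • x) '' A) = m A) {γ : Equiv.Perm X}
    (hγ : γ ∈ wobblingGroup Γ X) (A : Set X) : m (γ '' A) = m A := by
  classical
  obtain ⟨E, hE⟩ := hγ
  suffices H : ∀ A : Set X, (∀ x ∈ A, ∃ g ∈ E, γ x = g • x) → m (γ '' A) = m A from
    H A fun x _ => hE x
  clear hE
  induction E using Finset.induction_on with
  | empty =>
    intro A hA
    have : A = ∅ := Set.eq_empty_of_forall_notMem fun x hx => by simpa using hA x hx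
    simp [this]
  | insert g E _ ih =>
    intro A hA
    set A₁ : Set X := {x | x ∈ A ∧ γ x = g • x} with hA₁
    have hsub : A₁ ⊆ A := fun x hx => hx.1
    have hdisj : Disjoint A₁ (A \ A₁) := Set.disjoint_sdiff_right
    have h1 : m (γ '' A₁) = m A₁ := by
      rw [← h g A₁]
      congr 1
      exact Set.image_congr fun x hx => hx.2
    have h2 : m (γ '' (A \ A₁)) = m (A \ A₁) := by
      refine ih _ fun x hx => ?_
      obtain ⟨g', hg', hgx⟩ := hA x hx.1
      rcases Finset.mem_insert.1 hg' with rfl | hg'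
      · exact absurd ⟨hx.1, hgx⟩ hx.2
      · exact ⟨g', hg', hgx⟩
    rw [← Set.union_sdiff_cancel hsub, Set.image_union,
      hm.union _ _ ((Set.disjoint_image_iff γ.injective).2 hdisj), hm.union _ _ hdisj, h1, h2]

open FreeGroup in
/-- A free action of the free group of rank two is paradoxical: pulling back the sets of words with
a given first letter along an equivariant map `X → F₂` gives four disjoint sets; for each
generator, the two sets belonging to it cover `X` once one of them is translated. -/
theorem not_invariant_of_semiregular_freeGroup {m : Set X → ℝ}
    (hm : IsFinitelyAdditiveProbability m) (ρ : FreeGroup (Fin 2) →* Equiv.Perm X)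
    (hρ : ∀ w, w ≠ 1 → ∀ x, ρ w x ≠ x) (hinv : ∀ w A, m (ρ w '' A) = m A) : False := by
  let S : Setoid X :=
    { r := fun x y => ∃ u, ρ u x = y
      iseqv :=
        { refl := fun x => ⟨1, by simp⟩
          symm := by
            rintro x y ⟨u, rfl⟩
            exact ⟨u⁻¹, by rw [← Equiv.Perm.mul_apply, ← _root_.map_mul]; simp⟩
          trans := by
            rintro x y z ⟨u, rfl⟩ ⟨v, rfl⟩
            exact ⟨v * u, by rw [_root_.map_mul, Equiv.Perm.mul_apply]⟩ } }
  let r : X → X := fun x => (Quotient.mk S x).out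
  have hr : ∀ x, ∃ u, ρ u (r x) = x := fun x =>
    Quotient.exact (s := S) (Quotient.out_eq (Quotient.mk S x))
  have hr' : ∀ u x, r (ρ u x) = r x := fun u x =>
    congrArg Quotient.out (Quotient.sound (s := S) (Setoid.symm' S ⟨u, rfl⟩))
  -- Freeness makes the word carrying the representative of an orbit to a given point unique, so
  -- that `c` is equivariant.
  choose c hc using hr
  have hc' : ∀ u x, c (ρ u x) = u * c x := by
    intro u x
    by_contra hne
    refine hρ ((u * c x)⁻¹ * c (ρ u x)) (fun h => hne (inv_mul_eq_one.1 h).symm) (r x) ?_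
    have h1 := hc (ρ u x)
    rw [hr'] at h1
    rw [_root_.map_mul, Equiv.Perm.mul_apply, h1, _root_.map_inv, Equiv.Perm.inv_eq_iff_eq,
      _root_.map_mul, Equiv.Perm.mul_apply, hc]
  let P : Fin 2 × Bool → Set X := fun s => c ⁻¹' startsWith s
  have hdisj : ∀ s t, s ≠ t → Disjoint (P s) (P t) := fun s t hst =>
    (startsWith.disjoint_iff_ne.2 hst).preimage c
  -- The words starting with `s`, together with the `s`-translate of those starting with `s⁻¹`,
  -- exhaust the free group.
  have hcover : ∀ a : Fin 2, 1 ≤ m (P (a, true)) + m (P (a, false)) := by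
    intro a
    rw [← hm.univ, ← hinv (mk [(a, true)]) (P (a, false))]
    refine le_trans (hm.mono ?_) (hm.union_le _ _)
    intro x _
    by_cases hx : x ∈ P (a, true)
    · exact Or.inl hx
    · refine Or.inr ⟨ρ (mk [(a, true)])⁻¹ x, ?_, by
        rw [← Equiv.Perm.mul_apply, ← _root_.map_mul, mul_inv_cancel, _root_.map_one]; rfl⟩
      change c _ ∈ startsWith (a, false)
      rw [hc']
      exact startsWith_mk_mul (w := (a, false)) (c x) hx
  have h1 : m ((P (0, true) ∪ P (0, false)) ∪ (P (1, true) ∪ P (1, false))) ≤ 1 := by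
    rw [← hm.univ]; exact hm.mono (Set.subset_univ _)
  rw [hm.union _ _ (by
      simp only [Set.disjoint_union_left, Set.disjoint_union_right]
      refine ⟨⟨?_, ?_⟩, ?_, ?_⟩ <;> exact hdisj _ _ (by decide)),
    hm.union _ _ (hdisj _ _ (by decide)), hm.union _ _ (hdisj _ _ (by decide))] at h1
  linarith [hcover 0, hcover 1]

theorem HasSemiregularFreeSubgroup.exists_hom {W : Subgroup (Equiv.Perm X)}
    (h : HasSemiregularFreeSubgroup W) : ∃ ρ : FreeGroup (Fin 2) →* Equiv.Perm X,
      (∀ w, ρ w ∈ W) ∧ ∀ w, w ≠ 1 → ∀ x, ρ w x ≠ x := by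
  obtain ⟨H, hHW, hH, ⟨e⟩⟩ := h
  refine ⟨H.subtype.comp e.toMonoidHom, fun w => hHW (e w).2, fun w hw x => ?_⟩
  refine hH _ (e w).2 (fun h1 => hw ?_) x
  exact e.injective (Subtype.ext (by simpa using h1))

theorem hasSemiregularFreeSubgroup_of_hom [Nonempty X] {W : Subgroup (Equiv.Perm X)}
    (ρ : FreeGroup (Fin 2) →* Equiv.Perm X) (hW : ∀ w, ρ w ∈ W)
    (hρ : ∀ w, w ≠ 1 → ∀ x, ρ w x ≠ x) : HasSemiregularFreeSubgroup W := by
  have hinj : Function.Injective ρ := (injective_iff_map_eq_one ρ).2 fun w hw => by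
    by_contra hne
    exact hρ w hne (Classical.arbitrary X) (by simp [hw])
  refine ⟨ρ.range, ?_, ?_, ⟨MonoidHom.ofInjective hinj⟩⟩
  · rintro _ ⟨w, rfl⟩; exact hW w
  · rintro _ ⟨w, rfl⟩ hw x
    exact hρ w (fun h => hw (by simp [h])) x

theorem HasInvariantProbability.not_hasSemiregularFreeSubgroup {α : I → Equiv.Perm X}
    (h : HasInvariantProbability α) :
    ¬ HasSemiregularFreeSubgroup (wobblingGroupOf α) := by
  intro hF
  obtain ⟨ρ, hρW, hρ⟩ := hF.exists_hom
  obtain ⟨m, hm, hinv⟩ := h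
  exact not_invariant_of_semiregular_freeGroup hm ρ hρ fun w A =>
    image_invariant_of_mem_wobblingGroup hm
      (fun g A => image_invariant_of_mem_generatedGroup hinv g.2 A) (hρW w) A

end InvariantMeasures

/-! ### Restriction to the fibres of a direct sum -/

section Fibres

variable {I J X : Type*}

theorem exists_mem_generatedGroup_of_directSum {α : J → I → Equiv.Perm X}
    {γ : Equiv.Perm (X × J)} (hγ : γ ∈ generatedGroup (directSum α)) (j : J) :
    ∃ δ ∈ generatedGroup (α j), ∀ x, γ (x, j) = (δ x, j) := by
  induction hγ using Subgroup.closure_induction with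
  | mem γ hγ =>
    obtain ⟨i, rfl⟩ := hγ
    exact ⟨α j i, Subgroup.subset_closure ⟨i, rfl⟩, fun x => rfl⟩
  | one => exact ⟨1, one_mem _, fun x => rfl⟩
  | mul γ γ' _ _ h h' =>
    obtain ⟨δ, hδ, h⟩ := h
    obtain ⟨δ', hδ', h'⟩ := h'
    exact ⟨δ * δ', mul_mem hδ hδ', fun x => by
      rw [Equiv.Perm.mul_apply, h', h, Equiv.Perm.mul_apply]⟩
  | inv γ _ h =>
    obtain ⟨δ, hδ, h⟩ := h
    refine ⟨δ⁻¹, inv_mem hδ, fun x => ?_⟩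
    rw [Equiv.Perm.inv_eq_iff_eq, h]
    simp

/-- The wobbling group of a direct sum preserves each fibre, and a semi-regular subgroup acts
faithfully on each fibre because its non-identity elements move every point. -/
theorem HasSemiregularFreeSubgroup.of_directSum [Nonempty X] {α : J → I → Equiv.Perm X}
    (h : HasSemiregularFreeSubgroup (wobblingGroupOf (directSum α))) (j : J) :
    HasSemiregularFreeSubgroup (wobblingGroupOf (α j)) := by
  classical
  obtain ⟨ρ, hρW, hρ⟩ := h.exists_hom
  have hfib : ∀ w, ∃ E : Finset (generatedGroup (α j)), ∀ x, ∃ g ∈ E,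
      ρ w (x, j) = (g • x, j) := by
    intro w
    obtain ⟨E, hE⟩ := hρW w
    choose! δ hδ hδ' using
      fun γ : generatedGroup (directSum α) => exists_mem_generatedGroup_of_directSum γ.2 j
    refine ⟨E.image fun γ => ⟨δ γ, hδ γ⟩, fun x => ?_⟩
    obtain ⟨g, hg, hx⟩ := hE (x, j)
    refine ⟨_, Finset.mem_image_of_mem _ hg, ?_⟩
    rw [hx]
    exact hδ' g x
  have hj : ∀ w x, ρ w (x, j) = ((ρ w (x, j)).1, j) := by
    intro w x
    obtain ⟨E, hE⟩ := hfib w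
    obtain ⟨g, _, hx⟩ := hE x
    rw [hx]
  have hcomp : ∀ v w x, (ρ (v * w) (x, j)).1 = (ρ v ((ρ w (x, j)).1, j)).1 := by
    intro v w x
    rw [map_mul, Equiv.Perm.mul_apply, ← hj]
  let _ : MulAction (FreeGroup (Fin 2)) X :=
    { smul := fun w x => (ρ w (x, j)).1
      one_smul := fun x => by
        change (ρ 1 (x, j)).1 = x
        simp
      mul_smul := hcomp }
  refine hasSemiregularFreeSubgroup_of_hom (MulAction.toPermHom (FreeGroup (Fin 2)) X)
    (fun w => ?_) (fun w hw x hx => hρ w hw (x, j) ?_)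
  · obtain ⟨E, hE⟩ := hfib w
    refine ⟨E, fun x => ?_⟩
    obtain ⟨g, hg, hx⟩ := hE x
    exact ⟨g, hg, congrArg Prod.fst hx⟩
  · rw [hj]
    exact congrArg (fun y => (y, j)) hx

end Fibres

/-! ### Limits of bounded families along ultrafilters -/

section Limits

/-- The functional `L` is only meaningful on bounded families; linearity and positivity follow from
uniqueness of limits. -/
theorem exists_ultrafilter_limit {ι : Type*} (𝒰 : Ultrafilter ι) :
    ∃ L : (ι → ℝ) → ℝ, ∀ u : ι → ℝ, (∃ C, ∀ i, |u i| ≤ C) →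
      Filter.Tendsto u 𝒰 (𝓝 (L u)) := by
  have h : ∀ u : ι → ℝ, ∃ a : ℝ, (∃ C, ∀ i, |u i| ≤ C) → Filter.Tendsto u 𝒰 (𝓝 a) := by
    intro u
    by_cases hu : ∃ C, ∀ i, |u i| ≤ C
    · obtain ⟨C, hC⟩ := hu
      obtain ⟨a, _, ha⟩ := (isCompact_Icc (a := -C) (b := C)).ultrafilter_le_nhds (𝒰.map u)
        (Filter.le_principal_iff.2 (Filter.mem_map.2 (Filter.univ_mem' fun i => abs_le.1 (hC i))))
      exact ⟨a, fun _ => ha⟩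
    · exact ⟨0, fun h => absurd h hu⟩
  choose L hL using h
  exact ⟨L, hL⟩

end Limits

/-! ### Invariant means from perturbed translations -/

section Means

variable {G : Type*} [Group G] [TopologicalSpace G] [IsTopologicalGroup G]

theorem rightUniformContinuous_iff {f : G → ℝ} :
    RightUniformContinuous G f ↔
      ∀ ε > 0, ∃ U ∈ 𝓝 (1 : G), ∀ x y, y * x⁻¹ ∈ U → dist (f x) (f y) < ε := by
  let _ : UniformSpace G := IsTopologicalGroup.rightUniformSpace G
  have hb := (𝓝 (1 : G)).basis_sets.comap fun p : G × G => p.2 * p.1⁻¹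
  rw [← uniformity_eq_comap_nhds_one' G] at hb
  unfold RightUniformContinuous
  rw [hb.uniformContinuous_iff Metric.uniformity_basis_dist]
  rfl

theorem abs_sum_comp_perm_sub_le {X : Type*} (f : X → ℝ) {C : ℝ} (hC : ∀ x, |f x| ≤ C)
    (β : Equiv.Perm X) (F : Finset X) [DecidablePred fun x => β x ∉ F] :
    |∑ x ∈ F, f (β x) - ∑ x ∈ F, f x| ≤ 2 * C * (F.filter fun x => β x ∉ F).card := by
  classical
  have h1 : ∑ x ∈ F, f (β x) = ∑ y ∈ F.map β.toEmbedding, f y := by simp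
  have h2 : ((F.map β.toEmbedding) \ F).card = (F.filter fun x => β x ∉ F).card := by
    rw [← Finset.card_map (s := F.filter fun x => β x ∉ F) β.toEmbedding]
    congr 1
    ext y
    simp only [Finset.mem_sdiff, Finset.mem_map, Finset.mem_filter]
    constructor
    · rintro ⟨⟨x, hx, rfl⟩, hy⟩
      exact ⟨x, ⟨hx, hy⟩, rfl⟩
    · rintro ⟨x, ⟨hx, hy⟩, rfl⟩
      exact ⟨⟨x, hx, rfl⟩, hy⟩
  have h3 : (F \ (F.map β.toEmbedding)).card = (F.filter fun x => β x ∉ F).card := by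
    rw [← h2]
    exact (Finset.card_sdiff_comm (Finset.card_map _)).symm
  have hsum : ∀ S : Finset X, |∑ x ∈ S, f x| ≤ C * S.card := fun S =>
    (Finset.abs_sum_le_sum_abs _ _).trans
      ((Finset.sum_le_card_nsmul S _ C fun x _ => hC x).trans (by rw [nsmul_eq_mul, mul_comm]))
  rw [h1, ← Finset.sum_sdiff_sub_sum_sdiff]
  have a1 := hsum (F.map β.toEmbedding \ F)
  have a2 := hsum (F \ F.map β.toEmbedding)
  rw [h2] at a1
  rw [h3] at a2
  refine (abs_sub _ _).trans ?_
  linarith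

open scoped Classical in
/-- If perturbations of the left translation by arbitrarily small neighbourhoods have almost
invariant finite sets, then averaging over these sets gives, in the limit, an invariant mean on
`RUC_b(G)`: a right-uniformly continuous function does not distinguish a translation from a small
perturbation of it. -/
theorem isAmenable_of_perturbations
    (H : ∀ U ∈ 𝓝 (1 : G), ∀ (E : Finset G) (ε : ℝ), 0 < ε → ∃ α ∈ perturbations U,
      ∃ F : Finset G, F.Nonempty ∧
        ∀ g ∈ E, ((F.filter fun x => α g x ∉ F).card : ℝ) ≤ ε * F.card) :
    IsAmenable G := by
  have H' : ∀ K : Finset ({U // U ∈ 𝓝 (1 : G)} × G × ℕ), ∃ F : Finset G, F.Nonempty ∧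
      ∀ k ∈ K, ∃ β : Equiv.Perm G, (∀ x, ∃ u ∈ k.1.1, β x = u * (k.2.1 * x)) ∧
        ((F.filter fun x => β x ∉ F).card : ℝ) ≤ 1 / (k.2.2 + 1) * F.card := by
    intro K
    have hU : (⋂ k ∈ K, k.1.1) ∈ 𝓝 (1 : G) :=
      (Filter.biInter_finset_mem K).2 fun k _ => k.1.2
    obtain ⟨α, hα, F, hF, hαF⟩ := H _ hU (K.image fun k => k.2.1)
      (1 / ((K.sup fun k => k.2.2 : ℕ) + 1)) (by positivity)
    refine ⟨F, hF, fun k hk => ⟨α k.2.1, fun x => ?_, ?_⟩⟩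
    · obtain ⟨u, hu, h⟩ := hα k.2.1 x
      exact ⟨u, Set.mem_iInter₂.1 hu k hk, h⟩
    · refine (hαF _ (Finset.mem_image_of_mem _ hk)).trans ?_
      have : k.2.2 ≤ K.sup fun k => k.2.2 := Finset.le_sup (f := fun k => k.2.2) hk
      gcongr
  -- The finite sets `K` of constraints, ordered by inclusion, index the averages.
  choose F hF hFK using H'
  have hFpos : ∀ K, (0 : ℝ) < (F K).card := fun K => by exact_mod_cast (hF K).card_pos
  obtain ⟨L, hL⟩ := exists_ultrafilter_limit
    (Ultrafilter.of (Filter.atTop : Filter (Finset ({U // U ∈ 𝓝 (1 : G)} × G × ℕ))))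
  let avg : (G → ℝ) → Finset ({U // U ∈ 𝓝 (1 : G)} × G × ℕ) → ℝ :=
    fun f K => (∑ x ∈ F K, f x) / (F K).card
  have havg : ∀ f : RUCb G, ∃ C, ∀ K, |avg f K| ≤ C := by
    intro f
    obtain ⟨-, C, hC⟩ := f.2
    refine ⟨C, fun K => ?_⟩
    simp only [avg]
    rw [abs_div, abs_of_pos (hFpos K), div_le_iff₀ (hFpos K)]
    refine (Finset.abs_sum_le_sum_abs _ _).trans
      ((Finset.sum_le_card_nsmul _ _ C fun x _ => hC x).trans (by rw [nsmul_eq_mul, mul_comm]))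
  have ht := fun f : RUCb G => hL (avg f) (havg f)
  refine ⟨{ toFun := fun f => L (avg f), map_add' := fun f h => ?_, map_smul' := fun c f => ?_ },
    fun f hf => ?_, ?_, fun g f => ?_⟩
  · refine tendsto_nhds_unique (ht (f + h)) (((ht f).add (ht h)).congr fun K => ?_)
    simp only [avg, Submodule.coe_add, Pi.add_apply, Finset.sum_add_distrib, add_div]
  · refine tendsto_nhds_unique (ht (c • f)) (((ht f).const_mul c).congr fun K => ?_)
    simp only [avg, Submodule.coe_smul, Pi.smul_apply, smul_eq_mul, ← Finset.mul_sum, mul_div_assoc]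
  · exact ge_of_tendsto' (ht f) fun K =>
      div_nonneg (Finset.sum_nonneg fun x _ => hf x) (Nat.cast_nonneg _)
  · refine tendsto_nhds_unique (ht (RUCb.one G)) (tendsto_const_nhds.congr fun K => ?_)
    simp [avg, RUCb.one, (hFpos K).ne']
  · change L (avg (RUCb.translate g f)) = L (avg f)
    have hlim := (ht (RUCb.translate g f)).sub (ht f)
    obtain ⟨hf, C, hC⟩ := f.2
    have hC0 : 0 ≤ C := (abs_nonneg _).trans (hC 1)
    rw [← sub_eq_zero, ← abs_eq_zero]
    refine le_antisymm (le_of_forall_pos_le_add fun η hη => ?_) (abs_nonneg _)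
    rw [zero_add]
    obtain ⟨V, hV, hVf⟩ := rightUniformContinuous_iff.1 hf (η / 2) (half_pos hη)
    obtain ⟨n, hn⟩ := exists_nat_gt (2 * C / (η / 2))
    refine le_of_tendsto hlim.abs (Ultrafilter.of_le _ ?_)
    filter_upwards [Filter.mem_atTop {(⟨V, hV⟩, g, n)}] with K hK
    obtain ⟨β, hβ, hβF⟩ := hFK K (⟨V, hV⟩, g, n) (hK (Finset.mem_singleton_self _))
    have h1 : |∑ x ∈ F K, (f : G → ℝ) (g * x) - ∑ x ∈ F K, (f : G → ℝ) (β x)| ≤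
        η / 2 * (F K).card := by
      rw [← Finset.sum_sub_distrib]
      refine (Finset.abs_sum_le_sum_abs _ _).trans
        ((Finset.sum_le_card_nsmul _ _ (η / 2) fun x _ => ?_).trans
          (by rw [nsmul_eq_mul, mul_comm]))
      obtain ⟨u, hu, hx⟩ := hβ x
      exact (hVf (g * x) (β x) (by simpa [hx, mul_assoc] using hu)).le
    have h2 := abs_sum_comp_perm_sub_le (f : G → ℝ) hC β (F K)
    have h3 : 2 * C * ((F K).filter fun x => β x ∉ F K).card ≤ η / 2 * (F K).card := by
      calc _ ≤ 2 * C * (1 / (n + 1) * (F K).card) := by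
            dsimp only at hβF
            gcongr
        _ = (2 * C / (n + 1)) * (F K).card := by ring
        _ ≤ _ := by
          refine mul_le_mul_of_nonneg_right ?_ (Nat.cast_nonneg _)
          rw [div_lt_iff₀ (half_pos hη)] at hn
          rw [div_le_iff₀ (by positivity)]
          nlinarith
    simp only [avg]
    rw [← sub_div, abs_div, abs_of_pos (hFpos K), div_le_iff₀ (hFpos K)]
    calc |∑ x ∈ F K, (f : G → ℝ) (g * x) - ∑ x ∈ F K, (f : G → ℝ) x|
        ≤ |∑ x ∈ F K, (f : G → ℝ) (g * x) - ∑ x ∈ F K, (f : G → ℝ) (β x)| +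
          |∑ x ∈ F K, (f : G → ℝ) (β x) - ∑ x ∈ F K, (f : G → ℝ) x| := abs_sub_le _ _ _
      _ ≤ η * (F K).card := by linarith

open scoped Pointwise in
open scoped Classical in
/-- Expansion in every fibre, with a constant and a finite set independent of the fibre, adds up to
expansion of the direct sum. -/
theorem directSum_expansion {I J X Γ : Type*} [Group Γ] [MulAction Γ (X × J)]
    (α : J → I → Equiv.Perm X) (E : Finset I) (T : I → Γ)
    (hT : ∀ i x, T i • x = directSum α i x) {ε : ℝ}
    (hexp : ∀ (j : J) (B : Finset X), B.Nonempty →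
      ∃ i ∈ E, ε * B.card < (B.filter fun x => α j i x ∉ B).card) (F : Finset (X × J)) :
    (1 + ε) * F.card ≤ ((insert 1 (E.image T) : Finset Γ) • F).card := by
  have h1 : F.card = ∑ j ∈ F.image Prod.snd, (F.filter fun q => q.2 = j).card :=
    Finset.card_eq_sum_card_image _ _
  have h2 : ∑ j ∈ F.image Prod.snd,
      (((insert 1 (E.image T) : Finset Γ) • F).filter fun q => q.2 = j).card ≤
        ((insert 1 (E.image T) : Finset Γ) • F).card := by
    rw [← Finset.card_biUnion]
    · exact Finset.card_le_card (Finset.biUnion_subset.2 fun j _ => Finset.filter_subset _ _)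
    · intro i _ j _ hij
      refine Finset.disjoint_left.2 fun q hq hq' => hij ?_
      exact (Finset.mem_filter.1 hq).2.symm.trans (Finset.mem_filter.1 hq').2
  refine le_trans ?_ (Nat.cast_le.2 h2)
  rw [h1]
  push_cast
  rw [Finset.mul_sum]
  refine Finset.sum_le_sum fun j hj => ?_
  set B : Finset X := (F.filter fun q => q.2 = j).image Prod.fst with hB
  have hBmem : ∀ x, x ∈ B ↔ (x, j) ∈ F := by
    intro x
    simp only [hB, Finset.mem_image, Finset.mem_filter]
    constructor
    · rintro ⟨⟨y, i⟩, ⟨hq, rfl⟩, rfl⟩; exact hq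
    · exact fun hx => ⟨(x, j), ⟨hx, rfl⟩, rfl⟩
  have hBcard : B.card = (F.filter fun q => q.2 = j).card := by
    refine Finset.card_image_of_injOn fun p hp q hq hpq => Prod.ext hpq ?_
    rw [(Finset.mem_filter.1 hp).2, (Finset.mem_filter.1 hq).2]
  have hBne : B.Nonempty := by
    obtain ⟨q, hq, rfl⟩ := Finset.mem_image.1 hj
    exact ⟨q.1, (hBmem _).2 hq⟩
  obtain ⟨g, hg, hgB⟩ := hexp j B hBne
  have hdisj : Disjoint B ((B.filter fun x => α j g x ∉ B).image (α j g)) := by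
    refine Finset.disjoint_left.2 fun y hy hy' => ?_
    obtain ⟨x, hx, rfl⟩ := Finset.mem_image.1 hy'
    exact (Finset.mem_filter.1 hx).2 hy
  have hsub : (B ∪ (B.filter fun x => α j g x ∉ B).image (α j g)).image (fun x => (x, j)) ⊆
      ((insert 1 (E.image T) : Finset Γ) • F).filter fun q => q.2 = j := by
    intro q hq
    obtain ⟨x, hx, rfl⟩ := Finset.mem_image.1 hq
    refine Finset.mem_filter.2 ⟨?_, rfl⟩
    rcases Finset.mem_union.1 hx with hx | hx
    · exact Finset.mem_smul.2 ⟨1, Finset.mem_insert_self _ _, (x, j), (hBmem x).1 hx,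
        one_smul _ _⟩
    · obtain ⟨y, hy, rfl⟩ := Finset.mem_image.1 hx
      exact Finset.mem_smul.2 ⟨T g, Finset.mem_insert_of_mem (Finset.mem_image_of_mem _ hg),
        (y, j), (hBmem y).1 (Finset.mem_filter.1 hy).1, hT g (y, j)⟩
  have hcard := Finset.card_le_card hsub
  rw [Finset.card_image_of_injective _ (fun x y hxy => congrArg Prod.fst hxy),
    Finset.card_union_of_disjoint hdisj,
    Finset.card_image_of_injective _ (α j g).injective] at hcard
  rw [← hBcard]
  have hcard' : ((B.card : ℝ) + (B.filter fun x => α j g x ∉ B).card) ≤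
      (((insert 1 (E.image T) : Finset Γ) • F).filter fun q => q.2 = j).card := by
    exact_mod_cast hcard
  linarith

open scoped Classical in
theorem hasSemiregularFreeSubgroup_directSum_of_expansion {I J X : Type*} [Nonempty X] [Nonempty J]
    (α : J → I → Equiv.Perm X) (E : Finset I) {ε : ℝ} (hε : 0 < ε)
    (hexp : ∀ (j : J) (B : Finset X), B.Nonempty →
      ∃ i ∈ E, ε * B.card < (B.filter fun x => α j i x ∉ B).card) :
    HasSemiregularFreeSubgroup (wobblingGroupOf (directSum α)) := by
  let T : I → generatedGroup (directSum α) := fun i =>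
    ⟨directSum α i, Subgroup.subset_closure ⟨i, rfl⟩⟩
  have hexp' := directSum_expansion α E T (fun _ _ => rfl) hexp
  obtain ⟨ρ, hρW, hρ⟩ := exists_semiregular_hom_of_expansion _ (by linarith : 1 < 1 + ε)
    hexp' (Fin 2)
  exact hasSemiregularFreeSubgroup_of_hom ρ hρW hρ

open scoped Classical in
theorem exists_hasSemiregularFreeSubgroup_of_not_isAmenable (h : ¬ IsAmenable G) :
    ∃ U ∈ 𝓝 (1 : G), HasSemiregularFreeSubgroup (uWobblingGroup U) := by
  have h' := mt isAmenable_of_perturbations h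
  push Not at h'
  obtain ⟨U, hU, E, ε, hε, hexp⟩ := h'
  have : Nonempty (perturbations U) :=
    ⟨leftTranslation G, fun g x => ⟨1, mem_of_mem_nhds hU, by simp⟩⟩
  exact ⟨U, hU, hasSemiregularFreeSubgroup_directSum_of_expansion _ E hε
    fun j B hB => hexp j.1 j.2 B hB⟩

end Means

/-! ### Pseudometrics subordinate to an entourage -/

section Uniform

open scoped Uniformity in
/-- Every entourage contains a ball relation `dist < δ` of a pseudometric that is uniformly
continuous for the given uniformity: a sequence of entourages, each a composition root of the one
before, generates a coarser, countably generated uniformity. -/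
theorem exists_pseudoMetricSpace_of_mem_uniformity {X : Type*} [UniformSpace X]
    {S : Set (X × X)} (hS : S ∈ 𝓤 X) :
    ∃ d : PseudoMetricSpace X, 𝓤 X ≤ @uniformity X d.toUniformSpace ∧
      ∃ δ > 0, ∀ x y, d.dist x y < δ → (x, y) ∈ S := by
  have hstep : ∀ A : {A : Set (X × X) // A ∈ 𝓤 X}, ∃ B : {A : Set (X × X) // A ∈ 𝓤 X},
      (∀ x y, (x, y) ∈ B.1 → (y, x) ∈ B.1) ∧
      (∀ x y z, (x, y) ∈ B.1 → (y, z) ∈ B.1 → (x, z) ∈ A.1) := by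
    rintro ⟨A, hA⟩
    obtain ⟨B, hB, hsymm, hcomp⟩ := comp_symm_mem_uniformity_sets hA
    exact ⟨⟨B, hB⟩, fun x y h => hsymm.symm x y h, fun x y z h h' => hcomp ⟨y, h, h'⟩⟩
  choose half hsymm hcomp using hstep
  let V : ℕ → {A : Set (X × X) // A ∈ 𝓤 X} := fun n => half^[n] ⟨S, hS⟩
  have hV : ∀ n, V (n + 1) = half (V n) := fun n => Function.iterate_succ_apply' _ _ _
  have hrefl : ∀ n x, (x, x) ∈ (V n).1 := fun n x => refl_mem_uniformity (V n).2
  have hVsub : ∀ n, (V (n + 1)).1 ⊆ (V n).1 := by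
    rintro n ⟨x, y⟩ h
    rw [hV] at h
    exact hcomp _ x y y h (by rw [← hV]; exact hrefl _ y)
  have hanti : Antitone fun n => (V n).1 := antitone_nat_of_succ_le hVsub
  let B : FilterBasis (X × X) :=
    { sets := Set.range fun n => (V n).1
      nonempty := ⟨_, 0, rfl⟩
      inter_sets := by
        rintro _ _ ⟨n, rfl⟩ ⟨m, rfl⟩
        exact ⟨_, ⟨max n m, rfl⟩, Set.subset_inter (hanti (le_max_left n m))
          (hanti (le_max_right n m))⟩ }
  let c : UniformSpace.Core X := UniformSpace.Core.mkOfBasis B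
    (by rintro _ ⟨n, rfl⟩ x; exact hrefl n x)
    (by
      rintro _ ⟨n, rfl⟩
      refine ⟨_, ⟨n + 1, rfl⟩, ?_⟩
      rintro ⟨x, y⟩ h
      refine hVsub n ?_
      dsimp only at h ⊢
      rw [hV] at h ⊢
      exact hsymm _ _ _ h)
    (by
      rintro _ ⟨n, rfl⟩
      refine ⟨_, ⟨n + 1, rfl⟩, ?_⟩
      rintro ⟨x, z⟩ ⟨y, h, h'⟩
      dsimp only at h h'
      rw [hV] at h h'
      exact hcomp _ _ _ _ h h')
  let u : UniformSpace X := UniformSpace.ofCore c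
  have hbasis : (@uniformity X u).HasBasis (fun _ : ℕ => True) fun n => (V n).1 := by
    refine ⟨fun t => ?_⟩
    have : t ∈ @uniformity X u ↔ ∃ s ∈ B, s ⊆ t := B.mem_filter_iff
    rw [this]
    constructor
    · rintro ⟨_, ⟨n, rfl⟩, h⟩; exact ⟨n, trivial, h⟩
    · rintro ⟨n, -, h⟩; exact ⟨_, ⟨n, rfl⟩, h⟩
  have hcg : (@uniformity X u).IsCountablyGenerated :=
    Filter.HasCountableBasis.isCountablyGenerated ⟨hbasis, Set.to_countable _⟩
  obtain ⟨d, hd⟩ := @UniformSpace.metrizable_uniformity X u hcg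
  refine ⟨d, ?_, ?_⟩
  · rw [hd]
    exact hbasis.ge_iff.2 fun n _ => (V n).2
  · have h0 : S ∈ @uniformity X d.toUniformSpace := by
      rw [hd]
      exact hbasis.mem_of_mem (i := 0) trivial
    obtain ⟨δ, hδ, h⟩ := (@Metric.mem_uniformity_dist X d S).1 h0
    exact ⟨δ, hδ, fun x y hxy => h hxy⟩

end Uniform

/-! ### Almost invariant averages in amenable groups -/

section Reiter

variable {G : Type*} [Group G] [TopologicalSpace G] [IsTopologicalGroup G]

/-- For every identity neighbourhood `V` there are functions `f T` with `𝟙_T ≤ f T ≤ 𝟙_{VT}` that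
are right-uniformly continuous uniformly in the set `T`. -/
theorem exists_equicontinuous_bumps {V : Set G} (hV : V ∈ 𝓝 (1 : G)) :
    ∃ f : Set G → G → ℝ, (∀ T x, 0 ≤ f T x) ∧ (∀ T x, f T x ≤ 1) ∧ (∀ T, ∀ x ∈ T, f T x = 1) ∧
      (∀ T x, f T x ≠ 0 → ∃ t ∈ T, x * t⁻¹ ∈ V) ∧
      ∀ ε > 0, ∃ U ∈ 𝓝 (1 : G), ∀ x y, y * x⁻¹ ∈ U → ∀ T, |f T x - f T y| ≤ ε := by
  let _ : UniformSpace G := IsTopologicalGroup.rightUniformSpace G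
  have hS : {p : G × G | p.2 * p.1⁻¹ ∈ V} ∈ uniformity G := by
    rw [uniformity_eq_comap_nhds_one' G]
    exact Filter.preimage_mem_comap hV
  obtain ⟨d, hd, δ, hδ, hdV⟩ := exists_pseudoMetricSpace_of_mem_uniformity hS
  refine ⟨fun T x => @thickenedIndicator G d.toPseudoEMetricSpace δ hδ T x, fun T x => ?_,
    fun T x => ?_, fun T x hx => ?_, fun T x hx => ?_, fun ε hε => ?_⟩
  · exact NNReal.coe_nonneg _
  · exact_mod_cast @thickenedIndicator_le_one G d.toPseudoEMetricSpace δ hδ T x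
  · dsimp only
    exact_mod_cast @thickenedIndicator_one G d.toPseudoEMetricSpace δ hδ T x hx
  · have h1 : x ∈ @Metric.thickening G d.toPseudoEMetricSpace δ T := by
      by_contra hcon
      exact hx (by
        dsimp only
        rw [@thickenedIndicator_zero G d.toPseudoEMetricSpace δ hδ T x hcon, NNReal.coe_zero])
    obtain ⟨t, ht, hxt⟩ := (@Metric.mem_thickening_iff δ G d T x).1 h1
    exact ⟨t, ht, hdV t x (by rw [@dist_comm G d]; exact hxt)⟩
  · have hη : 0 < ε * δ := by positivity
    have hmem : {p : G × G | d.dist p.1 p.2 < ε * δ} ∈ uniformity G :=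
      hd (@Metric.dist_mem_uniformity G d _ hη)
    rw [uniformity_eq_comap_nhds_one' G] at hmem
    obtain ⟨U, hU, hUsub⟩ := hmem
    refine ⟨U, hU, fun x y hxy T => ?_⟩
    have hdist : d.dist x y < ε * δ := hUsub (show (x, y) ∈ _ from hxy)
    have hl := @lipschitzWith_thickenedIndicator G d.toPseudoEMetricSpace δ hδ T
    have h2 := @LipschitzWith.dist_le_mul G NNReal d _ _ _ hl x y
    rw [NNReal.dist_eq] at h2
    refine h2.trans ?_
    rw [NNReal.coe_inv, Real.coe_toNNReal _ hδ.le, inv_mul_le_iff₀ hδ, mul_comm]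
    exact hdist.le

/-- A convex combination is replaced by a uniform average with repetitions, by rounding down large
multiples of the weights. -/
theorem exists_average_of_mem_convexHull {W : Type*} [NormedAddCommGroup W] [NormedSpace ℝ W]
    {A : Type*} (v : A → W) {b : W} (hb : b ∈ convexHull ℝ (Set.range v)) {η : ℝ} (hη : 0 < η) :
    ∃ (κ : Type) (_ : Fintype κ) (_ : Nonempty κ) (x : κ → A),
      ‖∑ i, v (x i)‖ ≤ (‖b‖ + η) * Fintype.card κ := by
  obtain ⟨ι, _, w, z, hw0, hw1, hz, rfl⟩ := mem_convexHull_iff_exists_fintype.1 hb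
  choose x hx using hz
  set b := ∑ i, w i • z i with hb_def
  obtain ⟨N, hN⟩ := exists_nat_gt ((∑ i, ‖z i‖ + Fintype.card ι * (‖b‖ + η)) / η)
  rw [div_lt_iff₀ hη] at hN
  let m : ι → ℕ := fun i => ⌊N * w i⌋₊
  have hm1 : ∀ i, (m i : ℝ) ≤ N * w i := fun i =>
    Nat.floor_le (mul_nonneg (Nat.cast_nonneg _) (hw0 i))
  have hm2 : ∀ i, N * w i - 1 ≤ (m i : ℝ) := fun i => by
    linarith [Nat.lt_floor_add_one (N * w i)]
  have hM : (N : ℝ) - Fintype.card ι ≤ ∑ i, (m i : ℝ) := by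
    calc (N : ℝ) - Fintype.card ι = ∑ i, (N * w i - 1) := by
          rw [Finset.sum_sub_distrib, ← Finset.mul_sum, hw1]; simp
      _ ≤ _ := Finset.sum_le_sum fun i _ => hm2 i
  have hsum : ‖∑ i, (m i : ℝ) • z i‖ ≤ N * ‖b‖ + ∑ i, ‖z i‖ := by
    have h1 : ∑ i, (m i : ℝ) • z i = (N : ℝ) • b - ∑ i, (N * w i - m i) • z i := by
      rw [hb_def, Finset.smul_sum, ← Finset.sum_sub_distrib]
      refine Finset.sum_congr rfl fun i _ => ?_
      rw [smul_smul, ← sub_smul, sub_sub_cancel]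
    rw [h1]
    refine (norm_sub_le _ _).trans (add_le_add ?_ ?_)
    · rw [norm_smul, Real.norm_natCast]
    · refine (norm_sum_le _ _).trans (Finset.sum_le_sum fun i _ => ?_)
      rw [norm_smul, Real.norm_of_nonneg (by linarith [hm1 i])]
      exact mul_le_of_le_one_left (norm_nonneg _) (by linarith [hm2 i])
  have hS : 0 ≤ ∑ i, ‖z i‖ := Finset.sum_nonneg fun i _ => norm_nonneg _
  have hcard : (Fintype.card (Σ i, Fin (m i)) : ℝ) = ∑ i, (m i : ℝ) := by simp
  have hb0 := norm_nonneg b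
  have hk : (0 : ℝ) ≤ Fintype.card ι := Nat.cast_nonneg _
  have hmain : N * ‖b‖ + ∑ i, ‖z i‖ ≤ (‖b‖ + η) * ∑ i, (m i : ℝ) := by
    have := mul_le_mul_of_nonneg_left hM (by positivity : 0 ≤ ‖b‖ + η)
    nlinarith
  refine ⟨Σ i, Fin (m i), inferInstance, ?_, fun q => x q.1, ?_⟩
  · rw [← Fintype.card_pos_iff, ← Nat.cast_pos (α := ℝ), hcard]
    have h1 : (Fintype.card ι : ℝ) * η < N * η := by nlinarith [mul_nonneg hk hb0]
    linarith [lt_of_mul_lt_mul_right h1 hη.le]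
  · rw [hcard, Fintype.sum_sigma]
    refine le_trans (le_of_eq ?_) (hsum.trans hmain)
    congr 1
    refine Finset.sum_congr rfl fun i _ => ?_
    simp [hx, Nat.cast_smul_eq_nsmul]

/-- Day's convexity argument for an equicontinuous family `f`. Were no average almost invariant
uniformly in `t`, a functional `Λ` on the product over `E` of copies of `ℓ^∞(T)` would separate `0`
from the vectors `(f t (g x) - f t x)`, `x ∈ G`. Applying its coordinates to `x ↦ f · x` gives
functions in `RUC_b(G)`, by equicontinuity, and these contradict the invariant mean. -/
theorem IsAmenable.exists_almost_invariant_average (hG : IsAmenable G) {T : Type*}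
    (f : T → G → ℝ) {C : ℝ} (hC : ∀ t x, |f t x| ≤ C)
    (hf : ∀ ε > 0, ∃ U ∈ 𝓝 (1 : G), ∀ x y, y * x⁻¹ ∈ U → ∀ t, |f t x - f t y| ≤ ε)
    (E : Finset G) {ε : ℝ} (hε : 0 < ε) :
    ∃ (κ : Type) (_ : Fintype κ) (_ : Nonempty κ) (x : κ → G),
      ∀ g ∈ E, ∀ t, |∑ i, (f t (g * x i) - f t (x i))| ≤ ε * Fintype.card κ := by
  classical
  obtain ⟨μ, hpos, hone, hinv⟩ := hG
  let w : G → lp (fun _ : T => ℝ) ⊤ := fun x =>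
    ⟨fun t => f t x, memℓp_infty ⟨C, by rintro _ ⟨t, rfl⟩; exact hC t x⟩⟩
  have hw : ∀ x t, w x t = f t x := fun _ _ => rfl
  let v : G → (E → lp (fun _ : T => ℝ) ⊤) := fun x g => w (g * x) - w x
  have hclosure : (0 : E → lp (fun _ : T => ℝ) ⊤) ∈ closure (convexHull ℝ (Set.range v)) := by
    by_contra hcon
    obtain ⟨Λ, u, hu0, hu⟩ := geometric_hahn_banach_point_closed
      (convex_convexHull ℝ (Set.range v)).closure isClosed_closure hcon
    rw [map_zero] at hu0
    -- The coordinate functionals of `Λ`, evaluated along `w`, are right-uniformly continuous.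
    have hΦ : ∀ g : E, (fun x => Λ (Pi.single g (w x))) ∈ RUCb G := by
      intro g
      have hnorm : ∀ a : lp (fun _ : T => ℝ) ⊤, |Λ (Pi.single g a)| ≤ ‖Λ‖ * ‖a‖ := fun a => by
        have := Λ.le_opNorm (Pi.single g a)
        rwa [Pi.norm_single] at this
      refine ⟨rightUniformContinuous_iff.2 fun η hη => ?_, ‖Λ‖ * |C|, fun x => ?_⟩
      · obtain ⟨U, hU, hUf⟩ := hf (η / (‖Λ‖ + 1)) (by positivity)
        refine ⟨U, hU, fun x y hxy => ?_⟩
        have h1 : ‖w x - w y‖ ≤ η / (‖Λ‖ + 1) :=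
          lp.norm_le_of_forall_le (by positivity) fun t => hUf x y hxy t
        rw [Real.dist_eq, ← map_sub, ← Pi.single_sub]
        refine (hnorm _).trans_lt ?_
        refine (mul_le_mul_of_nonneg_left h1 (norm_nonneg _)).trans_lt ?_
        rw [mul_div_assoc', div_lt_iff₀ (by positivity)]
        nlinarith [norm_nonneg Λ]
      · refine (hnorm _).trans (mul_le_mul_of_nonneg_left ?_ (norm_nonneg _))
        exact lp.norm_le_of_forall_le (abs_nonneg _) fun t => (hC t x).trans (le_abs_self C)
    let Φ : E → RUCb G := fun g => ⟨_, hΦ g⟩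
    have hΛv : ∀ x, Λ (v x) = ∑ g : E, ((Φ g : G → ℝ) (g * x) - (Φ g : G → ℝ) x) := by
      intro x
      have h1 : v x = ∑ g : E, Pi.single g (v x g) := (Finset.univ_sum_single (v x)).symm
      rw [h1, map_sum]
      refine Finset.sum_congr rfl fun g _ => ?_
      change Λ (Pi.single g (w (g * x) - w x)) = _
      rw [Pi.single_sub, map_sub]
    have h2 := hpos (∑ g : E, (RUCb.translate (g : G) (Φ g) - Φ g) - u • RUCb.one G) fun x => by
      have h3 : ((∑ g : E, (RUCb.translate (g : G) (Φ g) - Φ g) - u • RUCb.one G : RUCb G) :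
          G → ℝ) x = Λ (v x) - u := by
        rw [hΛv]
        simp [RUCb.one, RUCb.translate, Finset.sum_apply]
      rw [h3]
      linarith [hu (v x) (subset_closure (subset_convexHull ℝ _ ⟨x, rfl⟩))]
    rw [map_sub, map_sum, map_smul, hone] at h2
    simp only [map_sub, hinv, sub_self, Finset.sum_const_zero, smul_eq_mul] at h2
    linarith
  obtain ⟨b, hb, hb0⟩ := Metric.mem_closure_iff.1 hclosure (ε / 2) (half_pos hε)
  rw [dist_zero_left] at hb0
  obtain ⟨κ, hκ, hκ', x, hx⟩ := exists_average_of_mem_convexHull v hb (half_pos hε)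
  refine ⟨κ, hκ, hκ', x, fun g hg t => ?_⟩
  have h1 : ‖∑ i, v (x i)‖ ≤ ε * Fintype.card κ :=
    hx.trans (mul_le_mul_of_nonneg_right (by linarith) (Nat.cast_nonneg _))
  have h2 := (lp.norm_apply_le_norm ENNReal.top_ne_zero ((∑ i, v (x i)) ⟨g, hg⟩) t).trans
    ((norm_le_pi_norm (∑ i, v (x i)) ⟨g, hg⟩).trans h1)
  refine le_trans (le_of_eq ?_) h2
  rw [Real.norm_eq_abs, Finset.sum_apply]
  congr 1
  have h3 : ∀ s : Finset κ, ((∑ i ∈ s, v (x i) ⟨g, hg⟩ : lp (fun _ : T => ℝ) ⊤) : T → ℝ) t =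
      ∑ i ∈ s, (f t (g * x i) - f t (x i)) := by
    intro s
    rw [lp.coeFn_sum, Finset.sum_apply]
    rfl
  exact (h3 Finset.univ).symm

end Reiter

/-! ### Transfinite choice avoiding finite sets -/

section Selection

universe u

/-- Transfinite choice of points `h i ∈ S i` such that `h i` avoids a finite set depending on `h j`,
for all `j ≠ i`. The well-order has order type the cardinal of `ι`, so that at each step fewer than
`|S i|` points are forbidden. -/
theorem exists_family_avoiding {ι A : Type u} (S : ι → Set A) (hinf : ∀ i, (S i).Infinite)
    (hcard : ∀ i, Cardinal.mk ι ≤ Cardinal.mk (S i)) (B : ι → ι → A → Set A)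
    (hB : ∀ i j a, (B i j a).Finite) (hsymm : ∀ i j a b, a ∈ B i j b → b ∈ B j i a) :
    ∃ h : ι → A, (∀ i, h i ∈ S i) ∧ ∀ i j, i ≠ j → h i ∉ B i j (h j) := by
  classical
  obtain ⟨r, hr, hord⟩ := Cardinal.exists_ord_eq ι
  have hne : ∀ (i : ι) (rec : (j : ι) → r j i → A),
      (S i \ ⋃ j : {j // r j i}, B i j (rec j j.2)).Nonempty := by
    intro i rec
    rw [Set.sdiff_nonempty]
    intro hsub
    have hlt : Cardinal.mk {j // r j i} < Cardinal.mk ι := Cardinal.card_typein_lt i hord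
    have hle : Cardinal.mk (S i) ≤ Cardinal.mk {j // r j i} * Cardinal.aleph0 := by
      refine (Cardinal.mk_le_mk_of_subset hsub).trans ((Cardinal.mk_iUnion_le _).trans ?_)
      gcongr
      exact ciSup_le' fun j => (hB _ _ _).countable.le_aleph0
    rcases lt_or_ge (Cardinal.mk {j // r j i}) Cardinal.aleph0 with hfin | hfin
    · have : Finite {j // r j i} := Cardinal.lt_aleph0_iff_finite.1 hfin
      exact hinf i ((Set.finite_iUnion fun j => hB _ _ _).subset hsub)
    · rw [Cardinal.mul_aleph0_eq hfin] at hle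
      exact absurd (hcard i) (not_le.2 (hle.trans_lt hlt))
  let F : (i : ι) → ((j : ι) → r j i → A) → A := fun i rec => (hne i rec).some
  let h : ι → A := hr.toIsWellFounded.wf.fix F
  have hh : ∀ i, h i ∈ S i \ ⋃ j : {j // r j i}, B i j (h j) := by
    intro i
    have h1 : h i = F i fun j _ => h j := hr.toIsWellFounded.wf.fix_eq F i
    rw [h1]
    exact (hne i fun j _ => h j).some_mem
  have hlt : ∀ i j, r j i → h i ∉ B i j (h j) := fun i j hj hmem =>
    (hh i).2 (Set.mem_iUnion.2 ⟨⟨j, hj⟩, hmem⟩)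
  refine ⟨h, fun i => (hh i).1, fun i j hij hmem => ?_⟩
  rcases trichotomous_of r i j with hij' | hij' | hij'
  · exact hlt j i hij' (hsymm _ _ _ _ hmem)
  · exact hij hij'
  · exact hlt i j hij' hmem

end Selection

/-! ### Matchings with deficiency -/

section Hall

open scoped Classical in
/-- Hall's theorem with deficiency `d`, obtained by adding `d` elements related to every `i`. -/
theorem exists_partial_matching {κ : Type*} [Fintype κ] (r : κ → κ → Prop) (d : ℕ)
    (h : ∀ S : Finset κ, S.card ≤ (Finset.univ.filter fun j => ∃ i ∈ S, r i j).card + d) :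
    ∃ (D : Finset κ) (m : κ → κ), Set.InjOn m D ∧ (∀ i ∈ D, r i (m i)) ∧
      Fintype.card κ ≤ D.card + d := by
  classical
  -- The `d` elements on the right are related to every `i`.
  let t : κ → Finset (κ ⊕ Fin d) := fun i =>
    (Finset.univ.filter fun j => r i j).disjSum Finset.univ
  have hall : ∀ S : Finset κ, S.card ≤ (S.biUnion t).card := by
    intro S
    rcases S.eq_empty_or_nonempty with rfl | ⟨i₀, hi₀⟩
    · simp
    have h1 : S.biUnion t =
        (Finset.univ.filter fun j => ∃ i ∈ S, r i j).disjSum Finset.univ := by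
      ext (j | j)
      · simp [t]
      · simpa [t] using ⟨i₀, hi₀⟩
    rw [h1, Finset.card_disjSum, Finset.card_univ, Fintype.card_fin]
    exact h S
  obtain ⟨f, hf, hft⟩ := (Finset.all_card_le_biUnion_card_iff_exists_injective t).1 hall
  let m : κ → κ := fun i => (f i).elim id fun _ => i
  have hm : ∀ i, (f i).isLeft → f i = Sum.inl (m i) := by
    intro i hi
    obtain ⟨j, hj⟩ := Sum.isLeft_iff.1 hi
    simp [m, hj]
  refine ⟨Finset.univ.filter fun i => (f i).isLeft, m, ?_, ?_, ?_⟩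
  · intro i hi j hj hij
    have hi' := hm i (by simpa using hi)
    have hj' := hm j (by simpa using hj)
    exact hf (by rw [hi', hj', hij])
  · intro i hi
    have h1 := hft i
    rw [hm i (by simpa using hi)] at h1
    simpa [t] using h1
  · have h1 : (Finset.univ.filter fun i => ¬ (f i).isLeft).card ≤ d := by
      have h2 : ((Finset.univ.filter fun i => ¬ (f i).isLeft).image f) ⊆
          (Finset.univ : Finset (Fin d)).map Function.Embedding.inr := by
        intro y hy
        obtain ⟨i, hi, rfl⟩ := Finset.mem_image.1 hy
        have h3 : (f i).isRight := by simpa using hi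
        obtain ⟨k, hk⟩ := Sum.isRight_iff.1 h3
        simp [hk]
      have h3 := Finset.card_le_card h2
      rw [Finset.card_image_of_injective _ hf] at h3
      simpa using h3
    rw [← Finset.card_univ,
      ← Finset.card_filter_add_card_filter_not (s := Finset.univ) fun i => (f i).isLeft]
    omega

end Hall

/-! ### Følner sets in non-discrete groups -/

section Folner

variable {G : Type*} [Group G] [TopologicalSpace G] [IsTopologicalGroup G]

theorem neBot_punctured_nhds_one (hdisc : ¬ DiscreteTopology G) : (𝓝[≠] (1 : G)).NeBot := by
  rw [Filter.neBot_iff]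
  intro h
  exact hdisc (discreteTopology_of_isOpen_singleton_one
    ((isOpen_singleton_iff_punctured_nhds 1).2 h))

open scoped Classical in
/-- Følner's criterion for a non-discrete amenable group, in a form ready for Hall's theorem: every
`S ⊆ F` has at least `|S| - ε |F|` neighbours in `F` for the relation `y ∈ U g x`. Moreover `F` is
disjoint from its translates by `E \ {1}`. This holds because the points of a multiset of almost
invariant averages can be moved slightly, every identity neighbourhood being infinite. -/
theorem IsAmenable.exists_folner_set [T2Space G] (hG : IsAmenable G) (hdisc : ¬ DiscreteTopology G)
    {U : Set G} (hU : U ∈ 𝓝 (1 : G)) (E : Finset G) {ε : ℝ} (hε : 0 < ε) :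
    ∃ F : Finset G, F.Nonempty ∧ (∀ g ∈ E, g ≠ 1 → ∀ x ∈ F, g * x ∉ F) ∧
      ∀ g ∈ E, ∀ S ⊆ F,
        (S.card : ℝ) ≤ (F.filter fun y => ∃ x ∈ S, ∃ u ∈ U, y = u * (g * x)).card + ε * F.card := by
  have hpunct := neBot_punctured_nhds_one hdisc
  obtain ⟨V, hV, hVU⟩ := exists_nhds_one_split4 hU
  have h1V : (1 : G) ∈ V := mem_of_mem_nhds hV
  set W : Set G := V ∩ ⋂ g ∈ E, {u | g * u⁻¹ * g⁻¹ ∈ V} with hWdef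
  have hW : W ∈ 𝓝 (1 : G) := by
    refine Filter.inter_mem hV ((Filter.biInter_finset_mem E).2 fun g _ => ?_)
    have hc : Continuous fun u : G => g * u⁻¹ * g⁻¹ := by fun_prop
    exact hc.tendsto 1 (by simpa using hV)
  obtain ⟨f, hf0, hf1, hfT, hfV, hfU⟩ := exists_equicontinuous_bumps hV
  obtain ⟨κ, _, _, x, hx⟩ := hG.exists_almost_invariant_average f (C := 1)
    (fun T y => by rw [abs_of_nonneg (hf0 T y)]; exact hf1 T y) hfU E hε
  -- Move the points `x i` slightly, to make them distinct and disjoint from their translates.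
  let E' : Set G := insert 1 ((E : Set G) ∪ (E : Set G)⁻¹)
  have hE' : E'.Finite := (E.finite_toSet.union E.finite_toSet.inv).insert 1
  have hE'inv : ∀ g ∈ E', g⁻¹ ∈ E' := by
    rintro g (rfl | hg | hg)
    · exact Or.inl (by simp)
    · exact Or.inr (Or.inr (by simpa using hg))
    · exact Or.inr (Or.inl hg)
  have hSinf : ∀ i : ULift κ, ((fun u => u * x i.down) '' W).Infinite := fun i =>
    (infinite_of_mem_nhds 1 hW).image (mul_left_injective _).injOn
  obtain ⟨y, hyS, hy⟩ := exists_family_avoiding (fun i : ULift κ => (fun u => u * x i.down) '' W)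
    hSinf (fun i => (Cardinal.lt_aleph0_of_finite _).le.trans
      (Cardinal.infinite_iff.1 (hSinf i).to_subtype))
    (fun _ _ a => (fun g => g * a) '' E') (fun _ _ a => hE'.image _) (by
      rintro i j _ b ⟨g, hg, rfl⟩
      exact ⟨g⁻¹, hE'inv g hg, by simp⟩)
  have hyE : ∀ g ∈ E', ∀ i j, i ≠ j → y i ≠ g * y j := fun g hg i j hij h =>
    hy i j hij ⟨g, hg, h.symm⟩
  have hyinj : Function.Injective y := by
    intro i j hij
    by_contra hne
    exact hyE 1 (Or.inl rfl) i j hne (by simpa using hij)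
  set F : Finset G := Finset.univ.image y with hF
  have hFcard : F.card = Fintype.card κ := by
    rw [hF, Finset.card_image_of_injective _ hyinj, Finset.card_univ, Fintype.card_ulift]
  refine ⟨F, Finset.univ_nonempty.image y, ?_, ?_⟩
  · intro g hg hg1 a ha ha'
    obtain ⟨i, -, rfl⟩ := Finset.mem_image.1 ha
    obtain ⟨j, -, hj⟩ := Finset.mem_image.1 ha'
    rcases eq_or_ne j i with rfl | hne
    · exact hg1 (by simpa using hj.symm)
    · exact hyE g (Or.inr (Or.inl hg)) j i hne hj
  · intro g hg S hS
    set S' : Finset κ := Finset.univ.filter fun i => y ⟨i⟩ ∈ S with hS'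
    have hScard : S.card = S'.card := by
      rw [← Finset.card_image_of_injective S' (f := fun i => y ⟨i⟩)
        (hyinj.comp ULift.up_injective)]
      congr 1
      ext a
      simp only [hS', Finset.mem_image, Finset.mem_filter, Finset.mem_univ, true_and]
      constructor
      · intro ha
        obtain ⟨i, -, rfl⟩ := Finset.mem_image.1 (hS ha)
        exact ⟨i.down, ha, rfl⟩
      · rintro ⟨i, hi, rfl⟩; exact hi
    set T : Set G := {a | ∃ i ∈ S', a = g * x i} with hT
    set R : Finset κ := Finset.univ.filter fun j => f T (x j) ≠ 0 with hR
    have h1 : (S'.card : ℝ) ≤ ∑ i, f T (g * x i) := by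
      calc (S'.card : ℝ) = ∑ i ∈ S', f T (g * x i) := by
            rw [Finset.sum_congr rfl fun i hi => hfT T _ ⟨i, hi, rfl⟩]; simp
        _ ≤ _ := Finset.sum_le_univ_sum_of_nonneg fun i => hf0 _ _
    have h2 : ∑ i, f T (x i) ≤ R.card := by
      rw [← Finset.sum_filter_ne_zero]
      refine (Finset.sum_le_card_nsmul _ _ 1 fun i _ => hf1 _ _).trans ?_
      simp [hR]
    have h3 := (abs_le.1 (hx g hg T)).2
    rw [Finset.sum_sub_distrib] at h3
    have h4 : R.card ≤ (F.filter fun b => ∃ a ∈ S, ∃ u ∈ U, b = u * (g * a)).card := by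
      rw [← Finset.card_image_of_injective R (f := fun i => y ⟨i⟩)
        (hyinj.comp ULift.up_injective)]
      refine Finset.card_le_card fun b hb => ?_
      obtain ⟨j, hj, rfl⟩ := Finset.mem_image.1 hb
      obtain ⟨_, ⟨i, hi, rfl⟩, hv⟩ := hfV T (x j) (Finset.mem_filter.1 hj).2
      obtain ⟨u, hu, huj⟩ := hyS ⟨j⟩
      obtain ⟨u', hu', hui⟩ := hyS ⟨i⟩
      have hu'V : g * u'⁻¹ * g⁻¹ ∈ V := Set.mem_iInter₂.1 hu'.2 g hg
      refine Finset.mem_filter.2 ⟨Finset.mem_image_of_mem _ (Finset.mem_univ _), y ⟨i⟩,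
        (Finset.mem_filter.1 hi).2, _, hVU hu.1 hv hu'V h1V, ?_⟩
      rw [← huj, ← hui]
      simp [mul_assoc]
    rw [hScard, hFcard]
    have h4' : (R.card : ℝ) ≤ (F.filter fun b => ∃ a ∈ S, ∃ u ∈ U, b = u * (g * a)).card := by
      exact_mod_cast h4
    linarith

end Folner

/-! ### Gluing partial matchings to a perturbation -/

section Gluing

theorem exists_perm_of_symmetric {X : Type*} (R : X → X → Prop) (hsymm : ∀ y z, R y z → R z y)
    (hfun : ∀ y z z', R y z → R y z' → z = z') :
    ∃ s : Equiv.Perm X, (∀ y z, R y z → s y = z) ∧ ∀ y, s y = y ∨ R y (s y) := by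
  classical
  let s : X → X := fun y => if h : ∃ z, R y z then h.choose else y
  have hs : ∀ y z, R y z → s y = z := by
    intro y z h
    have h' : ∃ z, R y z := ⟨z, h⟩
    have h1 : s y = h'.choose := dif_pos h'
    rw [h1]
    exact hfun y _ _ h'.choose_spec h
  have hs' : ∀ y, s y = y ∨ R y (s y) := by
    intro y
    by_cases h : ∃ z, R y z
    · obtain ⟨z, hz⟩ := h
      exact Or.inr (by rw [hs y z hz]; exact hz)
    · exact Or.inl (dif_neg h)
  have hinv : Function.Involutive s := by
    intro y
    rcases hs' y with h | h
    · rw [h, h]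
    · exact hs _ _ (hsymm _ _ h)
  exact ⟨hinv.toPerm, hs, hs'⟩

variable {G : Type*} [Group G]

open scoped Classical in
theorem exists_injOn_of_deficiency (F : Finset G) (U : Set G) (g : G) {ε : ℝ} (hε : 0 ≤ ε)
    (h : ∀ S ⊆ F, (S.card : ℝ) ≤
      (F.filter fun y => ∃ x ∈ S, ∃ u ∈ U, y = u * (g * x)).card + ε * F.card) :
    ∃ (D : Finset G) (m : G → G), D ⊆ F ∧ Set.InjOn m D ∧ (∀ x ∈ D, m x ∈ F) ∧
      (∀ x ∈ D, ∃ u ∈ U, m x = u * (g * x)) ∧ (F.card : ℝ) ≤ D.card + ε * F.card := by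
  have hd0 : (0 : ℝ) ≤ ε * F.card := by positivity
  obtain ⟨D, m, hinj, hr, hcard⟩ := exists_partial_matching
    (fun x y : F => ∃ u ∈ U, (y : G) = u * (g * x)) ⌊ε * F.card⌋₊ (by
      intro S
      have h1 := h (S.map (Function.Embedding.subtype _)) (by
        intro x hx
        obtain ⟨y, -, rfl⟩ := Finset.mem_map.1 hx
        exact y.2)
      rw [Finset.card_map] at h1
      have h2 : (F.filter fun y => ∃ x ∈ S.map (Function.Embedding.subtype _), ∃ u ∈ U,
          y = u * (g * x)).card ≤ (Finset.univ.filter fun j : F => ∃ i ∈ S, ∃ u ∈ U,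
          (j : G) = u * (g * i)).card := by
        rw [← Finset.card_map (Function.Embedding.subtype fun x => x ∈ F)]
        refine Finset.card_le_card fun y hy => ?_
        obtain ⟨hyF, x, hx, u, hu, hyx⟩ := Finset.mem_filter.1 hy
        obtain ⟨x', hx', rfl⟩ := Finset.mem_map.1 hx
        exact Finset.mem_map.2 ⟨⟨y, hyF⟩,
          Finset.mem_filter.2 ⟨Finset.mem_univ _, x', hx', u, hu, hyx⟩, rfl⟩
      have h3 : S.card - (Finset.univ.filter fun j : F => ∃ i ∈ S, ∃ u ∈ U,
          (j : G) = u * (g * i)).card ≤ ⌊ε * F.card⌋₊ := by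
        have h2' : ((F.filter fun y => ∃ x ∈ S.map (Function.Embedding.subtype _), ∃ u ∈ U,
          y = u * (g * x)).card : ℝ) ≤ (Finset.univ.filter fun j : F => ∃ i ∈ S, ∃ u ∈ U,
          (j : G) = u * (g * i)).card := by exact_mod_cast h2
        rcases le_total S.card (Finset.univ.filter fun j : F => ∃ i ∈ S, ∃ u ∈ U,
          (j : G) = u * (g * i)).card with hle | hle
        · omega
        · refine Nat.le_floor ?_
          rw [Nat.cast_sub hle]
          linarith
      omega)
  refine ⟨D.map (Function.Embedding.subtype _), fun x => if hx : x ∈ F then m ⟨x, hx⟩ else x,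
    ?_, ?_, ?_, ?_, ?_⟩
  · intro x hx
    obtain ⟨y, -, rfl⟩ := Finset.mem_map.1 hx
    exact y.2
  · intro x hx y hy hxy
    obtain ⟨x, hx', rfl⟩ := Finset.mem_map.1 hx
    obtain ⟨y, hy', rfl⟩ := Finset.mem_map.1 hy
    have hxy' : m x = m y := Subtype.ext (by simpa using hxy)
    rw [hinj hx' hy' hxy']
  · intro x hx
    obtain ⟨x, hx, rfl⟩ := Finset.mem_map.1 hx
    simp
  · intro x hx
    obtain ⟨x, hx', rfl⟩ := Finset.mem_map.1 hx
    simpa using hr x hx'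
  · rw [Finset.card_map]
    rw [Fintype.card_coe] at hcard
    have h1 : (F.card : ℝ) ≤ D.card + ⌊ε * F.card⌋₊ := by exact_mod_cast hcard
    linarith [Nat.floor_le hd0]

open scoped Pointwise in
open scoped Classical in
/-- Translating the pieces `F p` on the right makes them disjoint, and then for each `g` the
matchings `m p g` of all the pieces combine into one involution. -/
theorem exists_perturbation_of_matchings {P : Type*} {U : Set G} (h1U : (1 : G) ∈ U)
    (hUinv : ∀ u ∈ U, u⁻¹ ∈ U) (E : P → Finset G) (F : P → Finset G) (h : P → G)
    (hdisj : ∀ p q, p ≠ q → ∀ a ∈ F p ∪ (E p * F p), ∀ b ∈ F q ∪ (E q * F q), a * h p ≠ b * h q)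
    (hF : ∀ p, ∀ g ∈ E p, g ≠ 1 → ∀ x ∈ F p, g * x ∉ F p)
    (D : P → G → Finset G) (m : P → G → G → G)
    (hD : ∀ p, ∀ g ∈ E p, D p g ⊆ F p) (hinj : ∀ p, ∀ g ∈ E p, Set.InjOn (m p g) (D p g))
    (hmF : ∀ p, ∀ g ∈ E p, ∀ x ∈ D p g, m p g x ∈ F p)
    (hmU : ∀ p, ∀ g ∈ E p, ∀ x ∈ D p g, ∃ u ∈ U, m p g x = u * (g * x)) :
    ∃ α ∈ perturbations U, α 1 = 1 ∧
      ∀ p, ∀ g ∈ E p, g ≠ 1 → ∀ x ∈ D p g, α g (x * h p) = m p g x * h p := by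
  -- `R g` relates each translate `g x` of a matched point to its partner, in every piece.
  let R : G → G → G → Prop := fun g y z => ∃ p, g ∈ E p ∧ g ≠ 1 ∧ ∃ x ∈ D p g,
    (y = g * x * h p ∧ z = m p g x * h p) ∨ (y = m p g x * h p ∧ z = g * x * h p)
  have hmemF : ∀ p, ∀ g ∈ E p, ∀ x ∈ D p g, m p g x ∈ F p ∪ (E p * F p) := fun p g hg x hx =>
    Finset.mem_union_left _ (hmF p g hg x hx)
  have hmemE : ∀ p, ∀ g ∈ E p, ∀ x ∈ D p g, g * x ∈ F p ∪ (E p * F p) := fun p g hg x hx =>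
    Finset.mem_union_right _ (Finset.mul_mem_mul hg (hD p g hg hx))
  have hsymm : ∀ g y z, R g y z → R g z y := by
    rintro g y z ⟨p, hg, hg1, x, hx, ⟨rfl, rfl⟩ | ⟨rfl, rfl⟩⟩
    · exact ⟨p, hg, hg1, x, hx, Or.inr ⟨rfl, rfl⟩⟩
    · exact ⟨p, hg, hg1, x, hx, Or.inl ⟨rfl, rfl⟩⟩
  have hfun : ∀ g y z z', R g y z → R g y z' → z = z' := by
    rintro g y z z' ⟨p, hg, hg1, x, hx, hyz⟩ ⟨q, hg', -, x', hx', hyz'⟩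
    have hpq : p = q := by
      by_contra hne
      rcases hyz with ⟨rfl, -⟩ | ⟨rfl, -⟩ <;> rcases hyz' with ⟨h', -⟩ | ⟨h', -⟩
      · exact hdisj p q hne _ (hmemE p g hg x hx) _ (hmemE q g hg' x' hx') h'
      · exact hdisj p q hne _ (hmemE p g hg x hx) _ (hmemF q g hg' x' hx') h'
      · exact hdisj p q hne _ (hmemF p g hg x hx) _ (hmemE q g hg' x' hx') h'
      · exact hdisj p q hne _ (hmemF p g hg x hx) _ (hmemF q g hg' x' hx') h'
    subst hpq
    rcases hyz with ⟨rfl, rfl⟩ | ⟨rfl, rfl⟩ <;> rcases hyz' with ⟨h', rfl⟩ | ⟨h', rfl⟩ <;>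
      have h' := mul_right_cancel h'
    · rw [mul_left_cancel h']
    · exact absurd (h' ▸ hmF p g hg x' hx') (hF p g hg hg1 x (hD p g hg hx))
    · exact absurd (h' ▸ hmF p g hg x hx) (hF p g hg hg1 x' (hD p g hg hx'))
    · rw [hinj p g hg hx hx' h']
  choose s hs hs' using fun g => exists_perm_of_symmetric (R g) (hsymm g) (hfun g)
  refine ⟨fun g => s g * Equiv.mulLeft g, fun g x => ?_, ?_, fun p g hg hg1 x hx => ?_⟩
  · change ∃ u ∈ U, s g (g * x) = u * (g * x)
    rcases hs' g (g * x) with h' | ⟨p, hg, -, y, hy, ⟨h1, h2⟩ | ⟨h1, h2⟩⟩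
    · exact ⟨1, h1U, by rw [h', one_mul]⟩
    · obtain ⟨u, hu, hmu⟩ := hmU p g hg y hy
      exact ⟨u, hu, by rw [h2, h1, hmu]; simp [mul_assoc]⟩
    · obtain ⟨u, hu, hmu⟩ := hmU p g hg y hy
      exact ⟨u⁻¹, hUinv u hu, by rw [h2, h1, hmu]; simp [mul_assoc]⟩
  · ext x
    change s 1 (1 * x) = x
    rw [one_mul]
    rcases hs' 1 x with h' | ⟨_, _, h1, _⟩
    · exact h'
    · exact absurd rfl h1
  · change s g (g * (x * h p)) = _
    rw [← mul_assoc]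
    exact hs g _ _ ⟨p, hg, hg1, x, hx, Or.inl ⟨rfl, rfl⟩⟩

end Gluing

/-! ### Perturbations with an invariant probability -/

section InvariantPerturbations

open scoped Classical in
theorem hasInvariantProbability_of_folner {I X : Type*} (α : I → Equiv.Perm X)
    (h : ∀ (E : Finset I) (n : ℕ), ∃ F : Finset X, F.Nonempty ∧ ∀ i ∈ E,
      ((F.filter fun x => α i x ∉ F).card : ℝ) ≤ 1 / (n + 1) * F.card) :
    HasInvariantProbability α := by
  choose F hF hFα using h
  have hpos : ∀ E n, (0 : ℝ) < (F E n).card := fun E n => by exact_mod_cast (hF E n).card_pos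
  obtain ⟨L, hL⟩ := exists_ultrafilter_limit
    (Ultrafilter.of (Filter.atTop : Filter (Finset I × ℕ)))
  let χ : Set X → X → ℝ := fun A x => if x ∈ A then 1 else 0
  have hχ0 : ∀ A x, 0 ≤ χ A x := fun A x => by simp only [χ]; split_ifs <;> norm_num
  have hχ1 : ∀ A x, χ A x ≤ 1 := fun A x => by simp only [χ]; split_ifs <;> norm_num
  let avg : Set X → Finset I × ℕ → ℝ :=
    fun A p => (∑ x ∈ F p.1 p.2, χ A x) / (F p.1 p.2).card
  have havg0 : ∀ A p, 0 ≤ avg A p := fun A p =>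
    div_nonneg (Finset.sum_nonneg fun x _ => hχ0 A x) (Nat.cast_nonneg _)
  have ht := fun A => hL (avg A) ⟨1, fun p => by
    rw [abs_of_nonneg (havg0 A p), div_le_one (hpos _ _)]
    exact (Finset.sum_le_card_nsmul _ _ 1 fun x _ => hχ1 A x).trans (by simp)⟩
  refine ⟨fun A => L (avg A), ⟨?_, fun A => ge_of_tendsto' (ht A) (havg0 A), ?_⟩, ?_⟩
  · refine tendsto_nhds_unique (ht _) (tendsto_const_nhds.congr fun p => ?_)
    simp [avg, χ, (hpos _ _).ne']
  · intro A B hAB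
    refine tendsto_nhds_unique (ht _) (((ht A).add (ht B)).congr fun p => ?_)
    simp only [avg]
    rw [← add_div, ← Finset.sum_add_distrib]
    congr 1
    refine Finset.sum_congr rfl fun x _ => ?_
    simp only [χ, Set.mem_union]
    by_cases hA : x ∈ A
    · have hB : x ∉ B := Set.disjoint_left.1 hAB hA
      simp [hA, hB]
    · simp [hA]
  · intro i A
    have hlim := (ht A).sub (ht (α i '' A))
    rw [eq_comm, ← sub_eq_zero, ← abs_eq_zero]
    refine le_antisymm (le_of_forall_pos_le_add fun η hη => ?_) (abs_nonneg _)
    rw [zero_add]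
    obtain ⟨n, hn⟩ := exists_nat_gt (2 / η)
    refine le_of_tendsto hlim.abs (Ultrafilter.of_le _ ?_)
    filter_upwards [Filter.mem_atTop ({i}, n)] with p hp
    have h1 := abs_sum_comp_perm_sub_le (C := 1) (χ (α i '' A))
      (fun x => by rw [abs_of_nonneg (hχ0 _ x)]; exact hχ1 _ x) (α i) (F p.1 p.2)
    have h2 : ∀ x, χ (α i '' A) (α i x) = χ A x := fun x => by
      simp [χ]
    simp only [h2] at h1
    have h3 := hFα p.1 p.2 i (hp.1 (Finset.mem_singleton_self i))
    simp only [avg]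
    rw [← sub_div, abs_div, abs_of_pos (hpos _ _), div_le_iff₀ (hpos _ _)]
    refine h1.trans ?_
    have hnp : (n : ℝ) ≤ p.2 := by exact_mod_cast hp.2
    calc _ ≤ 2 * 1 * (1 / ((p.2 : ℝ) + 1) * (F p.1 p.2).card) := by gcongr
      _ = (2 / ((p.2 : ℝ) + 1)) * (F p.1 p.2).card := by ring
      _ ≤ _ := by
        refine mul_le_mul_of_nonneg_right ?_ (Nat.cast_nonneg _)
        rw [div_lt_iff₀ hη] at hn
        rw [div_le_iff₀ (by positivity)]
        nlinarith

variable {G : Type*} [Group G] [TopologicalSpace G] [IsTopologicalGroup G]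

theorem IsAmenable.hasInvariantProbability_leftTranslation [DiscreteTopology G]
    (hG : IsAmenable G) : HasInvariantProbability (leftTranslation G) := by
  classical
  obtain ⟨μ, hpos, hone, hinv⟩ := hG
  let χ : Set G → RUCb G := fun A =>
    ⟨fun x => if x ∈ A then 1 else 0, rightUniformContinuous_iff.2 fun ε hε =>
      ⟨{1}, by simp [nhds_discrete], fun x y hxy => by
        have : y = x := by simpa [mul_inv_eq_one] using hxy
        simpa [this] using hε⟩, 1, fun x => by
        dsimp only; split_ifs <;> simp⟩
  have hχ : ∀ A x, (χ A : G → ℝ) x = if x ∈ A then 1 else 0 := fun _ _ => rfl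
  refine ⟨fun A => μ (χ A), ⟨?_, fun A => hpos _ fun x => ?_, fun A B hAB => ?_⟩, fun g A => ?_⟩
  · rw [← hone]
    congr 1
    ext x
    simp [hχ, RUCb.one]
  · rw [hχ]; split_ifs <;> norm_num
  · rw [← map_add]
    congr 1
    ext x
    rw [Submodule.coe_add, Pi.add_apply, hχ, hχ, hχ]
    by_cases hA : x ∈ A
    · have hB : x ∉ B := Set.disjoint_left.1 hAB hA
      simp [hA, hB]
    · simp [hA]
  · change μ (χ (leftTranslation G g '' A)) = μ (χ A)
    rw [← hinv g (χ (leftTranslation G g '' A))]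
    congr 1
    ext x
    simp only [RUCb.translate, hχ]
    congr 1
    simp [leftTranslation]

open scoped Pointwise in
open scoped Classical in
/-- For a discrete group the left translation itself has an invariant probability. Otherwise the
Følner sets for all pairs `(E, n)`, with tolerance `1 / (n + 1)`, are placed disjointly by right
translations; there are only `|G|` such pairs. -/
theorem IsAmenable.exists_perturbation_hasInvariantProbability [T2Space G] (hG : IsAmenable G)
    {U : Set G} (hU : U ∈ 𝓝 (1 : G)) :
    ∃ α ∈ perturbations U, HasInvariantProbability α := by
  by_cases hdisc : DiscreteTopology G
  · exact ⟨leftTranslation G, fun g x => ⟨1, mem_of_mem_nhds hU, by simp⟩,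
      hG.hasInvariantProbability_leftTranslation⟩
  have hpunct := neBot_punctured_nhds_one hdisc
  have hGinf : Infinite G :=
    Set.infinite_univ_iff.1 (infinite_of_mem_nhds (1 : G) Filter.univ_mem)
  set V : Set G := U ∩ U⁻¹ with hVdef
  have hV : V ∈ 𝓝 (1 : G) := Filter.inter_mem hU (inv_mem_nhds_one G hU)
  have hVinv : ∀ u ∈ V, u⁻¹ ∈ V := fun u hu => ⟨hu.2, by simpa using hu.1⟩
  have hε : ∀ p : Finset G × ℕ, (0 : ℝ) < 1 / (p.2 + 1) := fun p => by positivity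
  choose F hF hFdisj hFS using fun p : Finset G × ℕ => hG.exists_folner_set hdisc hV p.1 (hε p)
  choose! D m hD hinj hmF hmU hcard using fun (p : Finset G × ℕ) (g : G) (hg : g ∈ p.1) =>
    exists_injOn_of_deficiency (F p) V g (hε p).le (hFS p g hg)
  let K : Finset G × ℕ → Finset G := fun p => F p ∪ (p.1 * F p)
  obtain ⟨h, -, hh⟩ := exists_family_avoiding (ι := Finset G × ℕ) (A := G) (fun _ => Set.univ)
    (fun _ => Set.infinite_univ) (fun _ => by simp)
    (fun p q a => {b | ∃ k ∈ K p, ∃ l ∈ K q, k * b = l * a})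
    (fun p q a => by
      refine (((K p)⁻¹ * K q).finite_toSet.image fun k => k * a).subset ?_
      rintro b ⟨k, hk, l, hl, hkl⟩
      exact ⟨k⁻¹ * l, Finset.mul_mem_mul (Finset.inv_mem_inv hk) hl, by
        simp only [mul_assoc]; rw [← hkl, inv_mul_cancel_left]⟩)
    (by
      rintro p q a b ⟨k, hk, l, hl, hkl⟩
      exact ⟨l, hl, k, hk, hkl.symm⟩)
  obtain ⟨α, hα, hα1, hαm⟩ := exists_perturbation_of_matchings (mem_of_mem_nhds hV) hVinv
    (fun p : Finset G × ℕ => p.1) F h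
    (fun p q hpq a ha b hb hab => hh p q hpq ⟨a, ha, b, hb, hab⟩) hFdisj D m hD hinj hmF hmU
  refine ⟨α, fun g x => ?_, hasInvariantProbability_of_folner α fun E n =>
    ⟨(F (E, n)).image fun x => x * h (E, n), (hF _).image _, fun g hg => ?_⟩⟩
  · obtain ⟨u, hu, hx⟩ := hα g x
    exact ⟨u, hu.1, hx⟩
  · rw [Finset.card_image_of_injective _ (mul_left_injective (h (E, n)))]
    -- The identity is not disjoint from itself on `F`, but it is not perturbed.
    rcases eq_or_ne g 1 with rfl | hg1
    · rw [hα1, Finset.filter_false_of_mem (by simp)]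
      simp only [Finset.card_empty, Nat.cast_zero]
      positivity
    · have h1 : (((F (E, n)).image fun x => x * h (E, n)).filter fun x =>
          α g x ∉ (F (E, n)).image fun x => x * h (E, n)) ⊆
          (F (E, n) \ D (E, n) g).image fun x => x * h (E, n) := by
        intro y hy
        obtain ⟨hy1, hy2⟩ := Finset.mem_filter.1 hy
        obtain ⟨x, hx, rfl⟩ := Finset.mem_image.1 hy1
        refine Finset.mem_image_of_mem _ (Finset.mem_sdiff.2 ⟨hx, fun hxD => hy2 ?_⟩)
        rw [hαm (E, n) g hg hg1 x hxD]
        exact Finset.mem_image_of_mem _ (hmF (E, n) g hg x hxD)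
      have h2 := Finset.card_le_card h1
      rw [Finset.card_image_of_injective _ (mul_left_injective (h (E, n)))] at h2
      have h3 : ((F (E, n) \ D (E, n) g).card : ℝ) = (F (E, n)).card - (D (E, n) g).card := by
        rw [Finset.card_sdiff_of_subset (hD (E, n) g hg),
          Nat.cast_sub (Finset.card_le_card (hD (E, n) g hg))]
      have h4 := hcard (E, n) g hg
      have h5 := (Nat.cast_le (α := ℝ)).2 h2
      rw [h3] at h5
      dsimp only at h4
      linarith

end InvariantPerturbations

end Wobbling

theorem corollary5p11 (G : Type*) [Group G] [TopologicalSpace G] [IsTopologicalGroup G]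
    [T2Space G] :
    List.TFAE
      [ ¬ Wobbling.IsAmenable G,
        ∃ U ∈ nhds (1 : G), ∀ α ∈ Wobbling.perturbations U,
          Wobbling.HasSemiregularFreeSubgroup (Wobbling.wobblingGroupOf α),
        ∃ U ∈ nhds (1 : G),
          Wobbling.HasSemiregularFreeSubgroup (Wobbling.uWobblingGroup U) ] := by
  tfae_have 1 → 3 := Wobbling.exists_hasSemiregularFreeSubgroup_of_not_isAmenable
  tfae_have 3 → 2 := by
    rintro ⟨U, hU, h⟩
    exact ⟨U, hU, fun α hα => h.of_directSum ⟨α, hα⟩⟩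
  tfae_have 2 → 1 := by
    rintro ⟨U, hU, h⟩ hG
    obtain ⟨α, hα, hm⟩ := hG.exists_perturbation_hasInvariantProbability hU
    exact hm.not_hasSemiregularFreeSubgroup (h α hα)
  tfae_finish
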